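/- Notation. For a permutation $\sigma=\sigma_1\cdots\sigma_m$ of $[m]=\{1,\dots,m\}$ and sets $X,Y$ of non-negative integers let $D_{m,s}^{X,Y}$ be the number of $\sigma$ with exactly $s$ indices $i<m$ such that $\sigma_i>\sigma_{i+1}$, $\sigma_i\in X$, $\sigma_{i+1}\in Y$; $A_{m,s}^{X,Y}$ the number of $\sigma$ with exactly $s$ indices $i<m$ such that $\sigma_i\in X$, $\sigma_{i+1}\in Y$; $V_{m,s}^{X,Y}$ the number of $\sigma$ with exactly $s$ indices $i\le m$ such that $i\in X$, $\sigma_i\in Y$. Write $A_m=A\cap[m]$, $A_m^c=[m]\setminus A$, $\alpha_{A,m,x}=|\{z: x<z\le m,\ z\notin A\}|$, $\beta_{B,m,x}=|\{z:1\le z<x,\ z\notin B\}|$, and let $$H_{m,s}^{A,B}=|A_m^c|!\sum_{r=0}^s(-1)^{s-r}\binom{|A_m^c|+r}{r}\binom{m+1}{s-r}\prod_{x\in A_m}(1+r+\alpha_{A,m,x}+\beta_{B,m,x})$$ be the alternating sum of Hall and Remmel. Let $(a)_p=a(a+1)\cdots(a+p-1)$ and $(a)\downarrow_p=a(a-1)\cdots(a-p+1)$,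 both $1$ for $p=0$; $i+k\mathbb N=\{i+ka:a\ge0\}$. Conventions: $\binom{-1}{0}=1$, and a product containing a binomial $\binom{a}{b}$ with $b<0$ or with $b>a\ge 0$ is $0$. Let $k\ge2$, $n,s\ge0$, $0\le t\le k-1$, $m=kn+t$. Residue classes modulo $k$ are represented by $1,\dots,k$ ($k$ representing the class of $0$). Define $$\begin{aligned} S_1&=((k-2)n+t)!\sum_{r=0}^s(-1)^{s-r}\tbinom{(k-2)n+t+r}{r}\tbinom{kn+t+1}{s-r}\,(1+r+(k-2)n+t)_n\,(1+r+(k-2)n+t)_n,\\ S_2&=((k-2)n+t-1)!\sum_{r=0}^s(-1)^{s-r}\tbinom{(k-2)n+t-1+r}{r}\tbinom{kn+t+1}{s-r}\,(r+(k-2)n+t)_{n+1}\,(r+(k-2)n+t)_n,\\ S_3&=((k-2)n+t-2)!\sum_{r=0}^s(-1)^{s-r}\tbinom{(k-2)n+t-2+r}{r}\tbinom{kn+t+1}{s-r}\,(r+(k-2)n+t-1)_{n+1}\,(r+(k-2)n+t-1)_{n+1},\\ S_{I}&=((k-1)n+t)!\sum_{r=0}^s(-1)^{s-r}\tbinom{(k-1)n+t+r}{r}\tbinom{kn+t+1}{s-r}\,(r+(k-1)n+t)\downarrow_n,\\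 S_{II}&=((k-1)n+t-1)!\sum_{r=0}^s(-1)^{s-r}\tbinom{(k-1)n+t-1+r}{r}\tbinom{kn+t+1}{s-r}\,(r+(k-1)n+t-1)\downarrow_{n+1},\\ S_{A}&=((k-1)n+t)!\sum_{r=0}^s(-1)^{s-r}\tbinom{(k-1)n+t+r}{r}\tbinom{kn+t+1}{s-r}\,(1+r+(k-1)n+t)\downarrow_n,\\ S_{B}&=((k-1)n+t-1)!\sum_{r=0}^s(-1)^{s-r}\tbinom{(k-1)n+t-1+r}{r}\tbinom{kn+t+1}{s-r}\,(r+(k-1)n+t)\downarrow_{n+1}, \end{aligned}$$ $$\begin{aligned} F_1&=\tbinom ns^2\tbinom{(k-1)n+t}{n-s}\,s!\,(n-s)!\,((k-1)n+t)!,\\ F_2&=\tbinom{n+1}s\tbinom ns\tbinom{(k-1)n+t}{n+1-s}\,s!\,(n+1-s)!\,((k-1)n+t-1)!,\\ F_3&=\tbinom{n+1}s^2\tbinom{(k-1)n+t-1}{n+1-s}\,s!\,(n+1-s)!\,((k-1)n+t-1)!,\\ F_A&=n!\,((k-1)n+t)!\tbinom{n-1}s\tbinom{(k-1)n+t+1}{n-s},\\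 F_B&=(n+1)!\,((k-1)n+t-1)!\tbinom ns\tbinom{(k-1)n+t}{n+1-s}. \end{aligned}$$ (a) Let $1\le i<j\le k$, $X=i+k\mathbb N$, $Y=j+k\mathbb N$, $A=X\cup Y$, $B=X$. Then $V_{m,s}^{X,Y}=V_{m,s}^{Y,X}=A_{m,s}^{X,Y}=A_{m,s}^{Y,X}=D_{m,s}^{A,B}=H_{m,s}^{A,B}$, and: if $0\le t<i$ then $V_{m,s}^{X,Y}=F_1$ and $H_{m,s}^{A,B}=S_1$; if $i\le t<j$ then $V_{m,s}^{X,Y}=F_2$ and $H_{m,s}^{A,B}=S_2$; if $j\le t\le k-1$ then $V_{m,s}^{X,Y}=F_3$ and $H_{m,s}^{A,B}=S_3$. (b) Let $1\le i\le k$ and $X=i+k\mathbb N$. If $0\le t<i$ then $V_{m,s}^{X,X}=F_1$; if $i\le t\le k-1$ then $V_{m,s}^{X,X}=F_3$. If moreover $i\ge2$, then for $B=(i-1+k\mathbb N)\cup(i+k\mathbb N)$ we have $V_{m,s}^{X,X}=D_{m,s}^{X,B}=H_{m,s}^{X,B}$, which equals $S_I$ if $0\le t<i$ and $S_{II}$ if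 $i\le t\le k-1$. (c) Let $1\le i\le k$, $X=i+k\mathbb N$ and $B=(i+k\mathbb N)\cup(i+1+k\mathbb N)$. Then $A_{m,s}^{X,X}=D_{m,s}^{X,B}=H_{m,s}^{X,B}$, and: if $0\le t<i$ then $A_{m,s}^{X,X}=F_A$ and $H_{m,s}^{X,B}=S_A$; if $i\le t\le k-1$ then $A_{m,s}^{X,X}=F_B$ and $H_{m,s}^{X,B}=S_B$. (d) Consequently, for all $0\le t\le k-1$: $F_1=S_1$; $F_2=S_2$ if $(k-2)n+t\ge1$; $F_3=S_3$ if $(k-2)n+t\ge2$; $F_1=S_I$; $F_3=S_{II}$ if $(k-1)n+t\ge1$; $F_A=S_A$; $F_B=S_B$ if $(k-1)n+t\ge1$. -/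

import Mathlib

open Finset
open scoped Nat

/-- The `i`-th letter (positions counted from `0` in `Fin m`) of the one-line notation of a
permutation of `{1, …, m}`, as a number in `{1, …, m}`. -/
def letter {m : ℕ} (σ : Equiv.Perm (Fin m)) (i : Fin m) : ℕ := (σ i : ℕ) + 1

open Classical in
/-- The number of `(X,Y)`-descents of `σ`: adjacent letters `a b` with `a > b`, `a ∈ X`, `b ∈ Y`. -/
noncomputable def desStat (X Y : Set ℕ) {m : ℕ} (σ : Equiv.Perm (Fin m)) : ℕ :=
  #{p : Fin m × Fin m | (p.2 : ℕ) = p.1 + 1 ∧ letter σ p.2 < letter σ p.1 ∧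
    letter σ p.1 ∈ X ∧ letter σ p.2 ∈ Y}

open Classical in
/-- The number of `(X,Y)`-adjacencies of `σ`: adjacent letters `a b` with `a ∈ X`, `b ∈ Y`. -/
noncomputable def adjStat (X Y : Set ℕ) {m : ℕ} (σ : Equiv.Perm (Fin m)) : ℕ :=
  #{p : Fin m × Fin m | (p.2 : ℕ) = p.1 + 1 ∧ letter σ p.1 ∈ X ∧ letter σ p.2 ∈ Y}

open Classical in
/-- The number of `(X,Y)`-place-value pairs of `σ`: positions in `X` (counted from `1`)
that carry a letter in `Y`. -/
noncomputable def valStat (X Y : Set ℕ) {m : ℕ} (σ : Equiv.Perm (Fin m)) : ℕ :=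
  #{i : Fin m | (i : ℕ) + 1 ∈ X ∧ letter σ i ∈ Y}

/-- `D_{m,s}^{X,Y}`: the number of permutations of `{1, …, m}` with exactly `s`
`(X,Y)`-descents. -/
noncomputable def numDes (m s : ℕ) (X Y : Set ℕ) : ℕ :=
  #{σ : Equiv.Perm (Fin m) | desStat X Y σ = s}

/-- `A_{m,s}^{X,Y}`: the number of permutations of `{1, …, m}` with exactly `s`
`(X,Y)`-adjacencies. -/
noncomputable def numAdj (m s : ℕ) (X Y : Set ℕ) : ℕ :=
  #{σ : Equiv.Perm (Fin m) | adjStat X Y σ = s}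

/-- `V_{m,s}^{X,Y}`: the number of permutations of `{1, …, m}` with exactly `s`
`(X,Y)`-place-value pairs. -/
noncomputable def numVal (m s : ℕ) (X Y : Set ℕ) : ℕ :=
  #{σ : Equiv.Perm (Fin m) | valStat X Y σ = s}

/-- The progression `i + kℕ = {i, i + k, i + 2k, …}`. -/
def prog (i k : ℕ) : Set ℕ := {x | ∃ a : ℕ, x = i + k * a}

/-- `c! ∑_{r=0}^{s} (-1)^{s-r} binom(c+r, r) binom(m+1, s-r) p(r)`. -/
def altSum (c m s : ℕ) (p : ℕ → ℕ) : ℤ :=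
  (c ! : ℤ) * ∑ r ∈ range (s + 1),
    (-1) ^ (s - r) * ((c + r).choose r : ℤ) * ((m + 1).choose (s - r) : ℤ) * (p r : ℤ)

open Classical in
/-- `α_{A,m,x}`: the number of `z ∉ A` with `x < z ≤ m`. -/
noncomputable def alphaStat (A : Set ℕ) (m x : ℕ) : ℕ := #{z ∈ Ioc x m | z ∉ A}

open Classical in
/-- `β_{B,m,x}` (which does not depend on `m`): the number of `z ∉ B` with `1 ≤ z < x`. -/
noncomputable def betaStat (B : Set ℕ) (x : ℕ) : ℕ := #{z ∈ Ico 1 x | z ∉ B}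

open Classical in
/-- The alternating sum of Hall and Remmel for `D_{m,s}^{A,B}`:
`|A_m^c|! ∑_{r=0}^{s} (-1)^{s-r} binom(|A_m^c|+r, r) binom(m+1, s-r)
∏_{x ∈ A_m} (1 + r + α_{A,m,x} + β_{B,m,x})`. -/
noncomputable def hallRemmel (m s : ℕ) (A B : Set ℕ) : ℤ :=
  altSum #{z ∈ Icc 1 m | z ∉ A} m s
    (fun r => ∏ x ∈ Icc 1 m with x ∈ A, (1 + r + alphaStat A m x + betaStat B x))

/-! ### Consecutive pairs in the rearrangements of a list -/

/-! Counts, alternating sums and closed forms are matched through common two-term recurrences, in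
which one letter is added at a time. For descents and adjacencies, let W be the sum of X^(number of
pairs) over all rearrangements of n letters, and insert a new letter into each of the n+1 gaps. A
letter that belongs to no pair can only break pairs, and W becomes (n+1)W + (1-X)W'. A letter that
is never a second entry, but may stand before d letters including every second entry of an existing
pair, gains a pair in d-s gaps of an arrangement with s pairs: W becomes (n+1-d+dX)W + (X-X^2)W'.
For adjacencies inside one set, a letter of the set gains on both sides, and d becomes twice the
number of letters of the set already present. An alternating sum is a coefficient of (1-X)^(m+1) ∑
G(r) X^r. Replacing G(r) by (r+1)G(r+1) differentiates the series and yields the first recurrence;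
multiplying G(r) by 1+r+m-d yields the second. Adding 1, 2, …, m in increasing order therefore
proves the Hall-Remmel formula (`coeff_pairPoly_eq_altCoeff`). The closed forms `placeForm` and
`adjForm` satisfy the second recurrence as well, with d equal to b, 2a+1 or 2a. This evaluates the
adjacency counts (`coeff_pairPoly_adj`, `coeff_pairPoly_adj_self`) and the alternating sums
(`altSum_ascFactorial_mul_ascFactorial`, `altSum_descFactorial`, `altSum_descFactorial_succ`).
Place-value pairs are counted directly, by choosing the image of the distinguished positions.
Progressions with the same difference interleave, so α+β is linear in the index of x and the
Hall-Remmel product becomes a rising or falling factorial. The final identities come from the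
evaluated sums alone, hence for every t. -/

open Classical in
/-- The number of consecutive pairs of a list that are related by `R`. -/
noncomputable def pairCount (R : ℕ → ℕ → Prop) : List ℕ → ℕ
  | a :: b :: l => (if R a b then 1 else 0) + pairCount R (b :: l)
  | _ => 0

open Polynomial in
/-- The generating polynomial of `pairCount R` over all rearrangements of `L`. -/
noncomputable def pairPoly (R : ℕ → ℕ → Prop) (L : List ℕ) : ℤ[X] :=
  (L.permutations'.map fun l => X ^ pairCount R l).sum

/-! ### The effect of inserting one letter into all gaps. -/

section Insertion
open Polynomial

variable {R : ℕ → ℕ → Prop}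

/-- The operator f ↦ u f + v f' is linear, so it suffices to check one arrangement of the old
letters at a time. -/
theorem pairPoly_cons {a : ℕ} {L : List ℕ} {u v : ℤ[X]}
    (h : ∀ l : List ℕ, l.Perm L → ((l.permutations'Aux a).map fun l' => X ^ pairCount R l').sum =
      u * X ^ pairCount R l + v * derivative (X ^ pairCount R l)) :
    pairPoly R (a :: L) = u * pairPoly R L + v * derivative (pairPoly R L) := by
  unfold pairPoly
  simp only [List.permutations'] at h ⊢
  have h' : ∀ l ∈ L.permutations', ((l.permutations'Aux a).map fun l' => X ^ pairCount R l').sum =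
      u * X ^ pairCount R l + v * derivative (X ^ pairCount R l) :=
    fun l hl => h l (List.mem_permutations'.1 hl)
  generalize L.permutations' = M at h'
  induction M with
  | nil => simp
  | cons l M ih =>
    rw [List.flatMap_cons, List.map_append, List.sum_append, h' l (by simp),
      ih fun l' hl' => h' l' (by simp [hl'])]
    simp only [List.map_cons, List.sum_cons, derivative_add]
    ring

theorem pairPoly_perm {L L' : List ℕ} (h : L.Perm L') : pairPoly R L = pairPoly R L' :=
  (h.permutations'.map _).sum_eq

/-- The letter `y` stays in front so that the induction sees the left neighbour of each gap; the gap
before `y` is added by the caller. If the list has s pairs, s gaps lose one pair and the others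
change nothing. -/
theorem sum_insert_of_unrelated_after {a : ℕ} (y : ℕ) (l : List ℕ)
    (h : ∀ z ∈ y :: l, ¬ R z a ∧ ¬ R a z) :
    ((l.permutations'Aux a).map fun l' => (X : ℤ[X]) ^ pairCount R (y :: l')).sum =
      ((l.length : ℤ[X]) + 1) * X ^ pairCount R (y :: l) +
        (1 - X) * derivative (X ^ pairCount R (y :: l)) := by
  induction l generalizing y with
  | nil => simp [pairCount, (h y (by simp)).1]
  | cons z l ih =>
    have ih := ih z fun w hw => h w (by simp [List.mem_cons.1 hw])
    simp only [List.permutations'Aux, List.map_cons, List.sum_cons, List.map_map,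
      Function.comp_def, pairCount, (h y (by simp)).1, (h z (by simp)).2, if_false, pow_add, zero_add]
    rw [List.sum_map_mul_left, ih]
    by_cases hR : R y z
    · simp only [hR, if_true, pow_one, derivative_mul, derivative_X, List.length_cons]
      push_cast; ring
    · simp only [hR, if_false, pow_zero, one_mul, List.length_cons]
      push_cast; ring

theorem pairPoly_cons_of_unrelated {a : ℕ} {L : List ℕ} (h : ∀ z ∈ L, ¬ R z a ∧ ¬ R a z) :
    pairPoly R (a :: L) =
      ((L.length : ℤ[X]) + 1) * pairPoly R L + (1 - X) * derivative (pairPoly R L) := by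
  refine pairPoly_cons fun l hl => ?_
  rw [← hl.length_eq]
  have h : ∀ z ∈ l, ¬ R z a ∧ ¬ R a z := fun z hz => h z (hl.subset hz)
  cases l with
  | nil => simp [pairCount]
  | cons y l =>
    simp only [List.permutations'Aux, List.map_cons, List.sum_cons, List.map_map,
      Function.comp_def]
    rw [sum_insert_of_unrelated_after y l h]
    simp only [pairCount, (h y (by simp)).2, if_false, zero_add, List.length_cons]
    push_cast; ring

open Classical in
-- Only the right neighbour z of a gap matters. If `R a z`, a pair is gained, unless the gap already
-- held a pair, which is broken in exchange; by `h'` every broken pair is compensated in this way.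
theorem sum_insert_of_source_after {a : ℕ} (y : ℕ) (l : List ℕ)
    (h : ∀ z ∈ y :: l, ¬ R z a) (h' : ∀ x ∈ y :: l, ∀ z ∈ y :: l, R x z → R a z) :
    ((l.permutations'Aux a).map fun l' => (X : ℤ[X]) ^ pairCount R (y :: l')).sum =
      ((l.length : ℤ[X]) + 1 - (l.countP (R a ·) : ℤ[X]) + (l.countP (R a ·) : ℤ[X]) * X) * X ^ pairCount R (y :: l) +
        (X - X ^ 2) * derivative (X ^ pairCount R (y :: l)) := by
  induction l generalizing y with
  | nil => simp [pairCount, h y (by simp)]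
  | cons z l ih =>
    have ih := ih z (fun w hw => h w (by simp [List.mem_cons.1 hw]))
      fun w hw v hv => h' w (by simp [List.mem_cons.1 hw]) v (by simp [List.mem_cons.1 hv])
    simp only [List.permutations'Aux, List.map_cons, List.sum_cons, List.map_map,
      Function.comp_def, pairCount, h y (by simp), if_false, pow_add, zero_add]
    rw [List.sum_map_mul_left, ih]
    by_cases hR : R y z
    · have ha := h' y (by simp) z (by simp) hR
      simp only [hR, ha, if_true, pow_one, derivative_mul, derivative_X, List.length_cons,
        List.countP_cons, decide_true]
      push_cast; ring
    · by_cases ha : R a z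
      · simp only [hR, ha, if_false, if_true, pow_zero, one_mul, List.length_cons,
          List.countP_cons, decide_true]
        push_cast; ring
      · simp only [hR, ha, if_false, pow_zero, one_mul, List.length_cons,
          List.countP_cons, decide_false, Bool.false_eq_true]
        push_cast; ring

open Classical in
theorem pairPoly_cons_of_source {a d : ℕ} {L : List ℕ} (h : ∀ z ∈ L, ¬ R z a)
    (h' : ∀ x ∈ L, ∀ z ∈ L, R x z → R a z) (hd : L.countP (R a ·) = d) :
    pairPoly R (a :: L) = ((L.length : ℤ[X]) + 1 - (d : ℤ[X]) + (d : ℤ[X]) * X) * pairPoly R L +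
      (X - X ^ 2) * derivative (pairPoly R L) := by
  subst hd
  refine pairPoly_cons fun l hl => ?_
  rw [← hl.length_eq, ← hl.countP_eq]
  have h : ∀ z ∈ l, ¬ R z a := fun z hz => h z (hl.subset hz)
  have h' : ∀ x ∈ l, ∀ z ∈ l, R x z → R a z :=
    fun x hx z hz => h' x (hl.subset hx) z (hl.subset hz)
  cases l with
  | nil => simp [pairCount]
  | cons y l =>
    simp only [List.permutations'Aux, List.map_cons, List.sum_cons, List.map_map,
      Function.comp_def]
    rw [sum_insert_of_source_after y l h h']
    by_cases ha : R a y
    · simp only [pairCount, ha, if_true, pow_add, List.length_cons, List.countP_cons, decide_true]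
      push_cast; ring
    · simp only [pairCount, ha, if_false, zero_add, List.length_cons, List.countP_cons,
        decide_false, Bool.false_eq_true]
      push_cast; ring

open Classical in
-- Every gap touching a letter of `S` gains exactly one pair: between two such letters one pair is
-- replaced by two. Each letter of `l` in `S` has two sides and `y` only its right one; the gaps
-- inside pairs are counted twice, which the derivative term corrects.
theorem sum_insert_of_mem_after {S : Set ℕ} {a : ℕ} (ha : a ∈ S) (y : ℕ) (l : List ℕ) :
    ((l.permutations'Aux a).map fun l' =>
        (X : ℤ[X]) ^ pairCount (fun x z => x ∈ S ∧ z ∈ S) (y :: l')).sum =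
      ((l.length : ℤ[X]) + 1 - (2 * (l.countP (· ∈ S) : ℤ[X]) + if y ∈ S then 1 else 0) +
          (2 * (l.countP (· ∈ S) : ℤ[X]) + if y ∈ S then 1 else 0) * X) *
          X ^ pairCount (fun x z => x ∈ S ∧ z ∈ S) (y :: l) +
        (X - X ^ 2) * derivative (X ^ pairCount (fun x z => x ∈ S ∧ z ∈ S) (y :: l)) := by
  induction l generalizing y with
  | nil => by_cases hy : y ∈ S <;> simp [pairCount, ha, hy]
  | cons z l ih =>
    simp only [List.permutations'Aux, List.map_cons, List.sum_cons, List.map_map,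
      Function.comp_def, pairCount, pow_add]
    rw [List.sum_map_mul_left, ih]
    by_cases hy : y ∈ S <;> by_cases hz : z ∈ S <;>
    · simp only [ha, hy, hz, and_true, and_false, and_self, if_true, if_false, pow_one, pow_zero,
        one_mul, derivative_mul, derivative_X, List.length_cons, List.countP_cons, decide_true,
        decide_false, Bool.false_eq_true]
      push_cast; ring

open Classical in
theorem pairPoly_cons_of_mem {S : Set ℕ} {a : ℕ} (ha : a ∈ S) (L : List ℕ) :
    pairPoly (fun x z => x ∈ S ∧ z ∈ S) (a :: L) =
      ((L.length : ℤ[X]) + 1 - 2 * (L.countP (· ∈ S) : ℤ[X]) + 2 * (L.countP (· ∈ S) : ℤ[X]) * X) *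
          pairPoly (fun x z => x ∈ S ∧ z ∈ S) L +
        (X - X ^ 2) * derivative (pairPoly (fun x z => x ∈ S ∧ z ∈ S) L) := by
  refine pairPoly_cons fun l hl => ?_
  rw [← hl.length_eq, ← hl.countP_eq]
  cases l with
  | nil => simp [pairCount]
  | cons y l =>
    simp only [List.permutations'Aux, List.map_cons, List.sum_cons, List.map_map,
      Function.comp_def]
    rw [sum_insert_of_mem_after ha y l]
    by_cases hy : y ∈ S <;>
    · simp only [pairCount, ha, hy, and_self, and_false, if_true, if_false, pow_add, pow_one,
        pow_zero, one_mul, List.length_cons, List.countP_cons, decide_true, decide_false,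
        Bool.false_eq_true]
      push_cast; ring

theorem pairPoly_eq_factorial {L : List ℕ} (h : ∀ x ∈ L, ∀ z ∈ L, ¬ R x z) :
    pairPoly R L = (L.length ! : ℤ[X]) := by
  induction L with
  | nil => simp [pairPoly, pairCount]
  | cons a L ih =>
    rw [pairPoly_cons_of_unrelated fun z hz =>
      ⟨h z (by simp [hz]) a (by simp), h a (by simp) z (by simp [hz])⟩,
      ih fun x hx z hz => h x (by simp [hx]) z (by simp [hz])]
    simp [Nat.factorial_succ]

end Insertion

/-! ### Permutations of `Fin m` as rearrangements of `1, …, m` -/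

open Classical in
theorem card_pairs_eq_pairCount (R : ℕ → ℕ → Prop) {m : ℕ} (w : Fin m → ℕ) :
    #{p : Fin m × Fin m | (p.2 : ℕ) = p.1 + 1 ∧ R (w p.1) (w p.2)} =
      pairCount R (List.ofFn w) := by
  cases m with
  | zero => simp [pairCount]
  | succ n =>
    have h1 : #{p : Fin (n + 1) × Fin (n + 1) | (p.2 : ℕ) = p.1 + 1 ∧ R (w p.1) (w p.2)} =
        #{i : Fin n | R (w i.castSucc) (w i.succ)} := by
      symm
      refine Finset.card_bij (fun i _ => (i.castSucc, i.succ)) (by simp) (by simp) ?_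
      rintro ⟨p, q⟩ h
      simp only [mem_filter, mem_univ, true_and] at h
      have hq := q.isLt
      refine ⟨⟨p, by omega⟩, ?_, ?_⟩
      · have : (⟨p, by omega⟩ : Fin n).succ = q := Fin.ext (by simp [h.1])
        simp [this, h.2]
      · exact Prod.ext (Fin.ext rfl) (Fin.ext (by simp [h.1]))
    rw [h1, Finset.card_filter]
    clear h1
    induction n with
    | zero => simp [pairCount]
    | succ n ih =>
      rw [Fin.sum_univ_succ, List.ofFn_succ, List.ofFn_succ, pairCount]
      congr 1
      have := ih fun i => w i.succ
      rw [List.ofFn_succ] at this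
      rw [← this]
      rfl

/-- Any ordering `L` of the letters is allowed, so each application can insert them in its own
convenient order. -/
theorem sum_perm_eq_sum_permutations' {M : Type*} [AddCommMonoid M] (f : List ℕ → M) {m : ℕ}
    {L : List ℕ} (hL : L.Perm (List.range' 1 m)) :
    ∑ σ : Equiv.Perm (Fin m), f (List.ofFn (letter σ)) = (L.permutations'.map f).sum := by
  classical
  have hn : L.permutations'.Nodup :=
    (List.permutations_perm_permutations' L).nodup_iff.1
      (List.nodup_permutations _ (hL.nodup_iff.2 List.nodup_range'))
  rw [← List.sum_toFinset f hn]
  refine Finset.sum_bij (fun σ _ => List.ofFn (letter σ)) ?_ ?_ ?_ (fun _ _ => rfl)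
  · intro σ _
    rw [List.mem_toFinset, List.mem_permutations']
    refine List.Perm.trans ?_ hL.symm
    rw [List.perm_ext_iff_of_nodup ?_ List.nodup_range']
    · intro x
      simp only [List.mem_ofFn, List.mem_range'_1, letter]
      constructor
      · rintro ⟨i, rfl⟩
        have := (σ i).isLt
        omega
      · rintro ⟨h1, h2⟩
        exact ⟨σ.symm ⟨x - 1, by omega⟩, by simp; omega⟩
    · rw [List.nodup_ofFn]
      intro i j h
      exact σ.injective (Fin.ext (by simpa [letter] using h))
  · intro σ _ τ _ h
    have := List.ofFn_injective h
    ext i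
    simpa [letter] using congrFun this i
  · intro l hl
    rw [List.mem_toFinset, List.mem_permutations'] at hl
    have hl := hl.trans hL
    have hlen : l.length = m := by simpa using hl.length_eq
    have hmem : ∀ i : Fin m, 1 ≤ l[i] ∧ l[i] < 1 + m := fun i =>
      List.mem_range'_1.1 (hl.subset (List.getElem_mem (by omega)))
    have hnd : l.Nodup := hl.nodup_iff.2 List.nodup_range'
    let g : Fin m → Fin m := fun i => ⟨l[i] - 1, by have := hmem i; omega⟩
    have hg : Function.Injective g := by
      intro i j h
      have h1 := hmem i
      have h2 := hmem j
      have h3 : l[i] - 1 = l[j] - 1 := congrArg Fin.val h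
      have h4 : l[(i : ℕ)] = l[(j : ℕ)] := by
        simp only [Fin.getElem_fin] at h1 h2 h3; omega
      exact Fin.ext ((hnd.getElem_inj_iff).1 h4)
    refine ⟨Equiv.ofBijective g (Finite.injective_iff_bijective.1 hg), mem_univ _, ?_⟩
    apply List.ext_getElem
    · simp [hlen]
    · intro i h1 h2
      have := hmem ⟨i, by omega⟩
      simp only [Fin.getElem_fin] at this
      simp [letter, g]
      omega

open Classical in
theorem card_perm_eq_coeff_pairPoly (R : ℕ → ℕ → Prop) {m : ℕ} (s : ℕ) {L : List ℕ}
    (hL : L.Perm (List.range' 1 m)) (f : Equiv.Perm (Fin m) → ℕ)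
    (hf : ∀ σ, f σ = pairCount R (List.ofFn (letter σ))) :
    ((#{σ : Equiv.Perm (Fin m) | f σ = s} : ℕ) : ℤ) = (pairPoly R L).coeff s := by
  rw [pairPoly, ← sum_perm_eq_sum_permutations' _ hL, Polynomial.finsetSum_coeff,
    Finset.card_filter]
  push_cast
  refine Finset.sum_congr rfl fun σ _ => ?_
  rw [Polynomial.coeff_X_pow, hf]
  simp only [eq_comm]

theorem numDes_eq_coeff {m : ℕ} (s : ℕ) (A B : Set ℕ) {L : List ℕ}
    (hL : L.Perm (List.range' 1 m)) :
    (numDes m s A B : ℤ) = (pairPoly (fun a b => b < a ∧ a ∈ A ∧ b ∈ B) L).coeff s := by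
  classical
  rw [← card_perm_eq_coeff_pairPoly _ s hL (desStat A B) fun σ => ?_]
  · unfold numDes; congr!
  · rw [← card_pairs_eq_pairCount, desStat]
    congr!

theorem numAdj_eq_coeff {m : ℕ} (s : ℕ) (A B : Set ℕ) {L : List ℕ}
    (hL : L.Perm (List.range' 1 m)) :
    (numAdj m s A B : ℤ) = (pairPoly (fun a b => a ∈ A ∧ b ∈ B) L).coeff s := by
  classical
  rw [← card_perm_eq_coeff_pairPoly _ s hL (adjStat A B) fun σ => ?_]
  · unfold numAdj; congr!
  · rw [← card_pairs_eq_pairCount, adjStat]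
    congr!

/-! ### Alternating sums as coefficients of `(1 - X) ^ (m + 1) * ∑ G r X ^ r` -/

/-- `∑_{r=0}^{s} (-1)^{s-r} binom(m+1, s-r) G(r)`. -/
def altCoeff (m : ℕ) (G : ℕ → ℤ) (s : ℕ) : ℤ :=
  ∑ r ∈ range (s + 1), (-1) ^ (s - r) * ((m + 1).choose (s - r) : ℤ) * G r

theorem altSum_eq_altCoeff (c m s : ℕ) (p : ℕ → ℕ) :
    altSum c m s p = altCoeff m (fun r => (c ! : ℤ) * (c + r).choose r * p r) s := by
  rw [altSum, altCoeff, Finset.mul_sum]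
  exact Finset.sum_congr rfl fun r _ => by ring

section Series
open PowerSeries

theorem coeff_one_sub_X_pow (n s : ℕ) :
    coeff s ((1 - X : ℤ⟦X⟧) ^ n) = (-1) ^ s * (n.choose s : ℤ) := by
  have h : ((1 - X : ℤ⟦X⟧) ^ n) = rescale (-1) ((1 + X) ^ n) := by
    rw [map_pow, map_add, map_one, rescale_X]
    simp [sub_eq_add_neg]
  have h' : ((1 + X : ℤ⟦X⟧) ^ n) = (((1 + Polynomial.X) ^ n : Polynomial ℤ) : ℤ⟦X⟧) := by
    simp
  rw [h, coeff_rescale, h', Polynomial.coeff_coe, Polynomial.coeff_one_add_X_pow]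

theorem altCoeff_eq_coeff (m : ℕ) (G : ℕ → ℤ) (s : ℕ) :
    altCoeff m G s = coeff s ((1 - X : ℤ⟦X⟧) ^ (m + 1) * PowerSeries.mk G) := by
  rw [mul_comm, coeff_mul, Finset.Nat.sum_antidiagonal_eq_sum_range_succ_mk, altCoeff]
  refine Finset.sum_congr rfl fun r _ => ?_
  rw [coeff_mk, coeff_one_sub_X_pow]
  ring

theorem derivative_one_sub_X_pow_mul (m : ℕ) (g : ℤ⟦X⟧) :
    (1 - X : ℤ⟦X⟧) ^ (m + 2) * d⁄dX ℤ g =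
      (1 - X) * d⁄dX ℤ ((1 - X) ^ (m + 1) * g) + ((m : ℤ⟦X⟧) + 1) * ((1 - X) ^ (m + 1) * g) := by
  have h1 : d⁄dX ℤ (1 - X : ℤ⟦X⟧) = -1 := by
    rw [map_sub, derivative_X]
    simp
  rw [Derivation.leibniz, Derivation.leibniz_pow, h1]
  simp only [smul_eq_mul, nsmul_eq_mul, Nat.add_sub_cancel]
  push_cast
  ring

/-- Differentiation of ∑ G(r) X^r, expressed through the numerator (1-X)^(m+1) ∑ G(r) X^r. The
result is the recurrence of `coeff_unrelated_step`. -/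
theorem altCoeff_shift (m : ℕ) (G : ℕ → ℤ) (s : ℕ) :
    altCoeff (m + 1) (fun r => (r + 1) * G (r + 1)) s =
      (m + 1 - s) * altCoeff m G s + (s + 1) * altCoeff m G (s + 1) := by
  have h : (PowerSeries.mk fun r => ((r : ℤ) + 1) * G (r + 1)) = d⁄dX ℤ (PowerSeries.mk G) := by
    ext r
    rw [coeff_mk, coeff_derivative, coeff_mk, mul_comm]
  simp only [altCoeff_eq_coeff]
  rw [h, derivative_one_sub_X_pow_mul]
  generalize (1 - X) ^ (m + 1) * PowerSeries.mk G = f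
  rw [sub_mul, one_mul, map_add, map_sub, coeff_derivative]
  have hc : ((m : ℤ⟦X⟧) + 1) = C ((m : ℤ) + 1) := by simp
  rw [hc, coeff_C_mul]
  cases s with
  | zero => simp; ring
  | succ s =>
    rw [coeff_succ_X_mul, coeff_derivative]
    push_cast
    ring

/-- Multiplying the coefficients by r is the operator X d/dX. The constant is normalised as 1+m-b so
that b plays the role of d in the source insertion. -/
theorem one_sub_X_pow_mul_mk_linear (m : ℕ) (b : ℤ) (G : ℕ → ℤ) :
    (1 - X : ℤ⟦X⟧) ^ (m + 2) * PowerSeries.mk (fun r => (1 + r + m - b) * G r) =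
      X * ((1 - X) * d⁄dX ℤ ((1 - X) ^ (m + 1) * PowerSeries.mk G) + ((m : ℤ⟦X⟧) + 1) * ((1 - X) ^ (m + 1) * PowerSeries.mk G)) +
        C (1 + m - b) * ((1 - X) * ((1 - X) ^ (m + 1) * PowerSeries.mk G)) := by
  rw [← derivative_one_sub_X_pow_mul]
  have h : PowerSeries.mk (fun r => (1 + (r : ℤ) + m - b) * G r) =
      X * d⁄dX ℤ (PowerSeries.mk G) + C (1 + m - b) * PowerSeries.mk G := by
    ext r
    rw [coeff_mk, map_add, coeff_C_mul, coeff_mk]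
    cases r with
    | zero => simp
    | succ r =>
      rw [coeff_succ_X_mul, coeff_derivative, coeff_mk]
      push_cast
      ring
  rw [h]
  ring

theorem altCoeff_linear_zero (m : ℕ) (b : ℤ) (G : ℕ → ℤ) :
    altCoeff (m + 1) (fun r => (1 + r + m - b) * G r) 0 = (m + 1 - b) * altCoeff m G 0 := by
  simp only [altCoeff, zero_add, Finset.sum_range_one, Nat.sub_self, Nat.choose_zero_right]
  push_cast
  ring

theorem altCoeff_linear_succ (m : ℕ) (b : ℤ) (G : ℕ → ℤ) (s : ℕ) :
    altCoeff (m + 1) (fun r => (1 + r + m - b) * G r) (s + 1) =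
      (b - s) * altCoeff m G s + (m + 1 - b + (s + 1)) * altCoeff m G (s + 1) := by
  simp only [altCoeff_eq_coeff]
  rw [one_sub_X_pow_mul_mk_linear]
  generalize (1 - X) ^ (m + 1) * PowerSeries.mk G = f
  have hc : ((m : ℤ⟦X⟧) + 1) = C ((m : ℤ) + 1) := by simp
  rw [hc, map_add, coeff_succ_X_mul, coeff_C_mul, sub_mul, one_mul, map_add,
    map_sub, coeff_C_mul, sub_mul 1 X f, one_mul, map_sub, coeff_succ_X_mul, coeff_derivative]
  cases s with
  | zero => simp; ring
  | succ s =>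
    rw [coeff_succ_X_mul, coeff_derivative]
    push_cast
    ring

end Series

/-! ### The insertion operators on coefficients. -/

section PolynomialCoefficients
open Polynomial

theorem coeff_unrelated_step (n : ℕ) (W : ℤ[X]) (s : ℕ) :
    (((n : ℤ[X]) + 1) * W + (1 - X) * derivative W).coeff s =
      (n + 1 - s) * W.coeff s + (s + 1) * W.coeff (s + 1) := by
  have hc : ((n : ℤ[X]) + 1) = C ((n : ℤ) + 1) := by simp
  rw [hc, coeff_add, coeff_C_mul, sub_mul, one_mul, coeff_sub, coeff_derivative]
  cases s with
  | zero => simp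
  | succ s =>
    rw [coeff_X_mul, coeff_derivative]
    push_cast
    ring

theorem coeff_source_step_zero (n d : ℕ) (W : ℤ[X]) :
    (((n : ℤ[X]) + 1 - (d : ℤ[X]) + (d : ℤ[X]) * X) * W + (X - X ^ 2) * derivative W).coeff 0 =
      (n + 1 - d) * W.coeff 0 := by
  simp [mul_coeff_zero]

theorem coeff_source_step_succ (n d : ℕ) (W : ℤ[X]) (s : ℕ) :
    (((n : ℤ[X]) + 1 - (d : ℤ[X]) + (d : ℤ[X]) * X) * W + (X - X ^ 2) * derivative W).coeff (s + 1) =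
      (d - s) * W.coeff s + (n + 1 - d + (s + 1)) * W.coeff (s + 1) := by
  have h : ((n : ℤ[X]) + 1 - (d : ℤ[X]) + (d : ℤ[X]) * X) * W + (X - X ^ 2) * derivative W =
      C ((n : ℤ) + 1 - d) * W + X * (C (d : ℤ) * W + derivative W - X * derivative W) := by
    simp only [map_sub, map_add, map_one, map_natCast]
    ring
  rw [h, coeff_add, coeff_C_mul, coeff_X_mul, coeff_sub, coeff_add, coeff_C_mul, coeff_derivative]
  cases s with
  | zero => simp; ring
  | succ s =>
    rw [coeff_X_mul, coeff_derivative]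
    push_cast
    ring

end PolynomialCoefficients

theorem altCoeff_zero_one (s : ℕ) : altCoeff 0 (fun _ => 1) s = if s = 0 then 1 else 0 := by
  rcases s with _ | _ | s
  · simp [altCoeff]
  · simp [altCoeff, Finset.sum_range_succ]
  · simp only [altCoeff]
    rw [Finset.sum_range_succ, Finset.sum_range_succ, Finset.sum_eq_zero]
    · simp
    · intro r hr
      rw [mem_range] at hr
      rw [Nat.choose_eq_zero_of_lt (by omega)]
      simp

/-! ### The formula of Hall and Remmel -/

theorem alphaStat_succ (A : Set ℕ) {m x : ℕ} (hx : x ≤ m) (hm : m + 1 ∉ A) :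
    alphaStat A (m + 1) x = alphaStat A m x + 1 := by
  classical
  unfold alphaStat
  rw [show Ioc x (m + 1) = insert (m + 1) (Ioc x m) by ext y; simp; omega, filter_insert,
    if_pos hm, card_insert_of_notMem (by simp)]

theorem alphaStat_succ_of_mem {A : Set ℕ} {m : ℕ} (x : ℕ) (hm : m + 1 ∈ A) :
    alphaStat A (m + 1) x = alphaStat A m x := by
  classical
  unfold alphaStat
  congr 1
  ext y
  simp only [mem_filter, mem_Ioc]
  constructor
  · rintro ⟨⟨h1, h2⟩, h3⟩
    have : y ≠ m + 1 := fun h => h3 (h ▸ hm)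
    exact ⟨⟨h1, by omega⟩, h3⟩
  · rintro ⟨⟨h1, h2⟩, h3⟩
    exact ⟨⟨h1, by omega⟩, h3⟩

theorem range'_succ_perm_cons (m : ℕ) :
    ((List.range' 1 (m + 1))).Perm ((m + 1) :: List.range' 1 m) := by
  rw [List.range'_concat]
  exact (List.perm_append_comm).trans (by simp [add_comm])

open Classical in
theorem countP_range'_add (B : Set ℕ) (m : ℕ) :
    (List.range' 1 m).countP (· ∈ B) + #{z ∈ Ico 1 (m + 1) | z ∉ B} = m := by
  have h : (List.range' 1 m).countP (· ∈ B) = #{z ∈ Ico 1 (m + 1) | z ∈ B} := by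
    rw [show Ico 1 (m + 1) = (List.range' 1 m).toFinset by ext; simp; omega,
      List.countP_eq_length_filter,
      ← List.toFinset_card_of_nodup (List.Nodup.filter _ List.nodup_range'), List.toFinset_filter]
    simp
  rw [h, Finset.card_filter_add_card_filter_not]
  simp

open Classical in
/-- The coefficients of the series that underlies `hallRemmel`. -/
noncomputable def hallRemmelTerm (A B : Set ℕ) (m r : ℕ) : ℤ :=
  ((#{z ∈ Icc 1 m | z ∉ A})! : ℤ) * (#{z ∈ Icc 1 m | z ∉ A} + r).choose r *
    (∏ x ∈ Icc 1 m with x ∈ A, (1 + r + alphaStat A m x + betaStat B x) : ℕ)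

theorem hallRemmelTerm_succ_of_mem {A : Set ℕ} (B : Set ℕ) {m : ℕ} (hm : m + 1 ∈ A) (r : ℕ) :
    hallRemmelTerm A B (m + 1) r =
      (1 + r + betaStat B (m + 1)) * hallRemmelTerm A B m r := by
  classical
  have hI : Icc 1 (m + 1) = insert (m + 1) (Icc 1 m) := by ext y; simp; omega
  unfold hallRemmelTerm
  simp only [alphaStat_succ_of_mem _ hm]
  rw [hI, filter_insert, filter_insert, if_pos hm, if_neg (by simpa using hm),
    prod_insert (by simp)]
  have : alphaStat A m (m + 1) = 0 := by simp [alphaStat]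
  rw [this]
  push_cast
  ring

/-- A new largest letter outside `A` raises every α by 1, which is the shift r ↦ r+1 in the product.
The prefactor is (r+1)(r+2)…(r+c), and lengthening it by one factor at the top is the same shift
times r+1. -/
theorem hallRemmelTerm_succ_of_notMem {A : Set ℕ} (B : Set ℕ) {m : ℕ} (hm : m + 1 ∉ A) (r : ℕ) :
    hallRemmelTerm A B (m + 1) r = (r + 1) * hallRemmelTerm A B m (r + 1) := by
  classical
  have hI : Icc 1 (m + 1) = insert (m + 1) (Icc 1 m) := by ext y; simp; omega
  unfold hallRemmelTerm
  have hp : ∏ x ∈ Icc 1 (m + 1) with x ∈ A, (1 + r + alphaStat A (m + 1) x + betaStat B x) =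
      ∏ x ∈ Icc 1 m with x ∈ A, (1 + (r + 1) + alphaStat A m x + betaStat B x) := by
    rw [hI, filter_insert, if_neg hm]
    refine prod_congr rfl fun x hx => ?_
    simp only [mem_filter, mem_Icc] at hx
    rw [alphaStat_succ A hx.1.2 hm]
    ring
  rw [hp, hI, filter_insert, if_pos hm, card_insert_of_notMem (by simp)]
  generalize #{z ∈ Icc 1 m | z ∉ A} = c
  have h := Nat.add_one_mul_choose_eq (c + r) r
  have h2 : (c + r + 1).choose (r + 1) * (r + 1) = (c + 1 + r).choose r * (c + 1) := by
    have h3 := Nat.choose_succ_right_eq (c + r + 1) r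
    rw [h3, show c + r + 1 - r = c + 1 by omega, show c + r + 1 = c + 1 + r by ring]
  have h2' : (((c + (r + 1)).choose (r + 1) : ℕ) : ℤ) * (r + 1) =
      ((c + 1 + r).choose r : ℕ) * (c + 1) := by exact_mod_cast h2
  rw [Nat.factorial_succ]
  push_cast
  linear_combination (-1 : ℤ) * (c ! : ℤ) *
    (∏ x ∈ Icc 1 m with x ∈ A, (1 + ((r : ℤ) + 1) + alphaStat A m x + betaStat B x)) * h2'

theorem hallRemmel_eq_altCoeff (m s : ℕ) (A B : Set ℕ) :
    hallRemmel m s A B = altCoeff m (hallRemmelTerm A B m) s := by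
  rw [hallRemmel, altSum_eq_altCoeff]
  rfl

/-- The largest letter m+1 is never the smaller entry of a descent. In `A` it is a source for the
letters of `B` in 1, …, m; outside `A` it is unrelated to all others. -/
theorem coeff_pairPoly_eq_altCoeff (A B : Set ℕ) (m s : ℕ) :
    (pairPoly (fun a b => b < a ∧ a ∈ A ∧ b ∈ B) (List.range' 1 m)).coeff s =
      altCoeff m (hallRemmelTerm A B m) s := by
  classical
  induction m generalizing s with
  | zero =>
    rw [pairPoly_eq_factorial (by simp)]
    have h : hallRemmelTerm A B 0 = fun _ => 1 := by
      funext r; simp [hallRemmelTerm]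
    rw [h, altCoeff_zero_one]
    simp [Polynomial.coeff_one]
  | succ m ih =>
    rw [pairPoly_perm (range'_succ_perm_cons m)]
    by_cases hm : m + 1 ∈ A
    · rw [pairPoly_cons_of_source (d := (List.range' 1 m).countP (· ∈ B))]
      · have hb := countP_range'_add B m
        set d := (List.range' 1 m).countP (· ∈ B)
        -- The new factor is 1+r+β, because α vanishes at the largest letter, and β = m-d.
        have hG : hallRemmelTerm A B (m + 1) =
            fun r => (1 + r + m - (d : ℤ)) * hallRemmelTerm A B m r := by
          funext r
          rw [hallRemmelTerm_succ_of_mem B hm, betaStat]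
          congr 1
          have hb : (d : ℤ) + (#{z ∈ Ico 1 (m + 1) | z ∉ B} : ℕ) = m := by exact_mod_cast hb
          linarith
        rw [hG, List.length_range']
        cases s with
        | zero => rw [coeff_source_step_zero, altCoeff_linear_zero, ih]
        | succ s => rw [coeff_source_step_succ, altCoeff_linear_succ, ih, ih]
      · intro z hz h
        have := (List.mem_range'_1.1 hz).2
        omega
      · intro x hx z hz h
        have := (List.mem_range'_1.1 hx).2
        exact ⟨by omega, hm, h.2.2⟩
      · refine List.countP_congr fun z hz => ?_
        have := (List.mem_range'_1.1 hz).2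
        simp [hm]
        omega
    · rw [pairPoly_cons_of_unrelated, coeff_unrelated_step, ih, ih, List.length_range',
        ← altCoeff_shift]
      · congr 1
        funext r
        rw [hallRemmelTerm_succ_of_notMem B hm]
      · intro z hz
        have := (List.mem_range'_1.1 hz).2
        exact ⟨fun h => by omega, fun h => hm h.2.1⟩

theorem numDes_eq_hallRemmel (m s : ℕ) (A B : Set ℕ) :
    (numDes m s A B : ℤ) = hallRemmel m s A B := by
  rw [numDes_eq_coeff s A B (List.Perm.refl _), coeff_pairPoly_eq_altCoeff, hallRemmel_eq_altCoeff]

/-! ### Closed forms -/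

/-- The number of permutations of `m = a + q = b + p` elements that map exactly `s` elements of a
given `a`-element set into a given `b`-element set. -/
def placeForm (a b p q s : ℕ) : ℕ :=
  a.choose s * b.choose s * p.choose (a - s) * s ! * (a - s)! * q !

/-- The number of permutations of `a + q` letters with exactly `s` adjacencies inside a given set
of `a` letters. -/
def adjForm (a q s : ℕ) : ℕ :=
  a ! * q ! * (a - 1).choose s * (q + 1).choose (a - s)

theorem sub_mul_choose (n j : ℕ) :
    ((n : ℤ) - j) * n.choose j = (j + 1) * n.choose (j + 1) := by
  rcases le_or_gt j n with h | h
  · have := Nat.choose_succ_right_eq n j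
    rw [← Nat.cast_sub h]
    exact_mod_cast (by rw [mul_comm, ← this, mul_comm])
  · simp [Nat.choose_eq_zero_of_lt h, Nat.choose_eq_zero_of_lt (h.trans (Nat.lt_succ_self j))]

theorem choose_mul_factorial_mul_factorial' (i j : ℕ) :
    (((i + j).choose i : ℕ) : ℤ) * i ! * j ! = ((i + j)! : ℕ) := by
  have := Nat.choose_mul_factorial_mul_factorial (Nat.le_add_right i j)
  rw [Nat.add_sub_cancel_left] at this
  exact_mod_cast this

theorem placeForm_of_lt {a s : ℕ} (h : a < s) (b p q : ℕ) : placeForm a b p q s = 0 := by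
  simp [placeForm, Nat.choose_eq_zero_of_lt h]

/-- Writing a = s+u removes the truncated subtraction and merges two factorials with a binomial. -/
theorem placeForm_add (s u b p q : ℕ) :
    (placeForm (s + u) b p q s : ℤ) = (s + u)! * b.choose s * p.choose u * q ! := by
  rw [← choose_mul_factorial_mul_factorial' s u, placeForm, Nat.add_sub_cancel_left]
  push_cast
  ring

theorem placeForm_succ_zero (a b p q : ℕ) :
    (placeForm (a + 1) b (p + 1) q 0 : ℤ) = (p + 1) * placeForm a b p q 0 := by
  have h : ((p : ℤ) + 1) * p.choose a = (p + 1).choose (a + 1) * (a + 1) := by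
    exact_mod_cast Nat.add_one_mul_choose_eq p a
  simp only [placeForm, Nat.choose_zero_right, Nat.sub_zero, Nat.factorial_zero,
    Nat.factorial_succ a]
  push_cast
  linear_combination (-(a ! : ℤ) * q !) * h

theorem placeForm_succ_succ (a b p q s : ℕ) :
    (placeForm (a + 1) b (p + 1) q (s + 1) : ℤ) =
      (b - s) * placeForm a b p q s + (p + 1 + (s + 1)) * placeForm a b p q (s + 1) := by
  have hb := sub_mul_choose b s
  rcases lt_trichotomy a s with h | rfl | h
  · simp [placeForm_of_lt h, placeForm_of_lt (h.trans (Nat.lt_succ_self s)),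
      placeForm_of_lt (Nat.succ_lt_succ h)]
  · rw [placeForm_of_lt (Nat.lt_succ_self a)]
    have h1 := placeForm_add (a + 1) 0 b (p + 1) q
    have h2 := placeForm_add a 0 b p q
    simp only [add_zero, Nat.choose_zero_right] at h1 h2
    rw [h1, h2, Nat.factorial_succ]
    push_cast
    linear_combination (-(a ! : ℤ) * q !) * hb
  · obtain ⟨u, rfl⟩ : ∃ u, a = s + 1 + u := ⟨a - (s + 1), by omega⟩
    have h1 := placeForm_add (s + 1) (u + 1) b (p + 1) q
    have h2 := placeForm_add s (u + 1) b p q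
    have h3 := placeForm_add (s + 1) u b p q
    rw [show s + 1 + (u + 1) = s + 1 + u + 1 by ring] at h1
    rw [show s + (u + 1) = s + 1 + u by ring] at h2
    rw [h1, h2, h3, Nat.factorial_succ]
    have hp : ((p : ℤ) + 1) * p.choose u = (p + 1).choose (u + 1) * (u + 1) := by
      exact_mod_cast Nat.add_one_mul_choose_eq p u
    have hp' : ((p + 1).choose (u + 1) : ℤ) = p.choose u + p.choose (u + 1) := by
      exact_mod_cast Nat.choose_succ_succ p u
    push_cast
    linear_combination (-((s + 1 + u)! : ℤ) * q ! * p.choose (u + 1)) * hb -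
      ((s + 1 + u)! : ℤ) * q ! * b.choose (s + 1) * hp +
      ((s + 1 + u)! : ℤ) * q ! * b.choose (s + 1) * (s + 1) * hp'

theorem placeForm_diag_succ_zero (a q : ℕ) :
    (placeForm (a + 1) (a + 1) q q 0 : ℤ) = (q - a) * placeForm a a q q 0 := by
  have h := sub_mul_choose q a
  simp only [placeForm, Nat.choose_zero_right, Nat.sub_zero, Nat.factorial_zero,
    Nat.factorial_succ a]
  push_cast
  linear_combination (-(a ! : ℤ) * q !) * h

theorem choose_succ_pascal (s u : ℕ) :
    (((s + 1 + u + 1).choose (s + 1) : ℕ) : ℤ) =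
        (s + 1 + u).choose s + (s + 1 + u).choose (s + 1) ∧
      ((u : ℤ) + 1) * (s + 1 + u).choose s = (s + 1) * (s + 1 + u).choose (s + 1) := by
  constructor
  · exact_mod_cast Nat.choose_succ_succ (s + 1 + u) s
  · have := sub_mul_choose (s + 1 + u) s
    rw [← this]
    push_cast
    ring

/-- Both sets grow together while their common complement keeps size q, so this is the second
recurrence with d = 2a+1. -/
theorem placeForm_diag_succ_succ (a q s : ℕ) :
    (placeForm (a + 1) (a + 1) q q (s + 1) : ℤ) =
      (2 * a + 1 - s) * placeForm a a q q s + (q - a + (s + 1)) * placeForm a a q q (s + 1) := by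
  rcases lt_trichotomy a s with h | rfl | h
  · simp [placeForm_of_lt h, placeForm_of_lt (h.trans (Nat.lt_succ_self s)),
      placeForm_of_lt (Nat.succ_lt_succ h)]
  · rw [placeForm_of_lt (Nat.lt_succ_self a)]
    have h1 := placeForm_add (a + 1) 0 (a + 1) q q
    have h2 := placeForm_add a 0 a q q
    simp only [add_zero, Nat.choose_zero_right, Nat.choose_self] at h1 h2
    rw [h1, h2, Nat.factorial_succ]
    push_cast
    ring
  · obtain ⟨u, rfl⟩ : ∃ u, a = s + 1 + u := ⟨a - (s + 1), by omega⟩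
    have h1 := placeForm_add (s + 1) (u + 1) (s + 1 + u + 1) q q
    have h2 := placeForm_add s (u + 1) (s + 1 + u) q q
    have h3 := placeForm_add (s + 1) u (s + 1 + u) q q
    rw [show s + 1 + (u + 1) = s + 1 + u + 1 by ring] at h1
    rw [show s + (u + 1) = s + 1 + u by ring] at h2
    rw [h1, h2, h3, Nat.factorial_succ]
    have hq := sub_mul_choose q u
    obtain ⟨hx, hy⟩ := choose_succ_pascal s u
    rw [hx]
    push_cast
    linear_combination ((s + 1 + u)! : ℤ) * q ! * (-(q.choose (u + 1) : ℤ) * hy -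
      ((s + 1 + u).choose (s + 1) : ℤ) * hq)

theorem adjForm_succ_zero (a q : ℕ) :
    (adjForm (a + 1) q 0 : ℤ) = (q + 1 - a) * adjForm a q 0 := by
  have h := sub_mul_choose (q + 1) a
  simp only [adjForm, Nat.choose_zero_right, Nat.sub_zero, Nat.factorial_succ a]
  push_cast at h ⊢
  linear_combination (-(a ! : ℤ) * q !) * h

theorem adjForm_succ_succ (a q s : ℕ) :
    (adjForm (a + 1) q (s + 1) : ℤ) =
      (2 * a - s) * adjForm a q s + (q + 1 - a + (s + 1)) * adjForm a q (s + 1) := by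
  -- The case a = 0 is separate because `a - 1` is truncated there.
  rcases a with _ | a
  · rcases s with _ | s <;> simp [adjForm]
  simp only [adjForm, Nat.add_sub_cancel, Nat.add_sub_add_right]
  rcases lt_trichotomy a s with h | rfl | h
  · simp [Nat.choose_eq_zero_of_lt h, Nat.choose_eq_zero_of_lt (h.trans (Nat.lt_succ_self s)),
      Nat.choose_eq_zero_of_lt (Nat.succ_lt_succ h)]
  · simp only [Nat.choose_self, Nat.choose_succ_self, Nat.factorial_succ (a + 1)]
    push_cast
    ring
  · obtain ⟨u, rfl⟩ : ∃ u, a = s + 1 + u := ⟨a - (s + 1), by omega⟩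
    obtain ⟨hx, hy⟩ := choose_succ_pascal s u
    have hq := sub_mul_choose (q + 1) (u + 1)
    rw [show s + 1 + u + 1 - s = u + 1 + 1 by omega, show s + 1 + u - s = u + 1 by omega,
      Nat.factorial_succ (s + 1 + u + 1)]
    push_cast at hx hq ⊢
    rw [hx]
    linear_combination ((s + 1 + u + 1)! : ℤ) * q ! *
      (-((q + 1).choose (u + 1 + 1) : ℤ) * hy - ((s + 1 + u).choose (s + 1) : ℤ) * hq)

/-! ### Evaluation of the alternating sums -/

/-- This is ∑ (r+1)(r+2)…(r+m) X^r = m!/(1-X)^(m+1), the base case of the three evaluations below.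
-/
theorem altCoeff_ascFactorial (m s : ℕ) :
    altCoeff m (fun r => ((r + 1).ascFactorial m : ℤ)) s = if s = 0 then (m ! : ℤ) else 0 := by
  induction m generalizing s with
  | zero => simpa using altCoeff_zero_one s
  | succ m ih =>
    have h : (fun r : ℕ => ((r + 1).ascFactorial (m + 1) : ℤ)) =
        fun r : ℕ => ((r : ℤ) + 1) * (fun r : ℕ => ((r + 1).ascFactorial m : ℤ)) (r + 1) := by
      funext r
      rw [Nat.ascFactorial]
      have := Nat.succ_ascFactorial (r + 1) m
      have h2 : (r + 1 + m) * (r + 1).ascFactorial m = (r + 1) * (r + 1 + 1).ascFactorial m := by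
        rw [← this, Nat.succ_eq_add_one]
      beta_reduce
      exact_mod_cast h2
    rw [h, altCoeff_shift m (fun r : ℕ => ((r + 1).ascFactorial m : ℤ)), ih, ih]
    rcases s with _ | s <;> simp [Nat.factorial_succ]

theorem factorial_mul_choose_eq_ascFactorial (c r : ℕ) :
    (c ! : ℤ) * (c + r).choose r = ((r + 1).ascFactorial c : ℕ) := by
  rw [Nat.ascFactorial_eq_factorial_mul_choose, add_comm c r, Nat.choose_symm_add]
  push_cast
  ring

/-- With m = c+b+a, the next factor 1+r+c+a equals 1+r+m-b, so increasing a is a source step with d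
= b. -/
theorem altSum_ascFactorial_mul_ascFactorial (a b c s : ℕ) :
    altSum c (c + b + a) s (fun r => (1 + r + c).ascFactorial a * (1 + r + c).ascFactorial b) =
      placeForm a b (c + a) (c + b) s := by
  rw [altSum_eq_altCoeff]
  simp only [factorial_mul_choose_eq_ascFactorial]
  induction a generalizing s with
  | zero =>
    have h : (fun r => (((r + 1).ascFactorial c : ℕ) : ℤ) *
        (((1 + r + c).ascFactorial 0 * (1 + r + c).ascFactorial b : ℕ) : ℤ)) =
        fun r => (((r + 1).ascFactorial (c + b) : ℕ) : ℤ) := by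
      funext r
      rw [← Nat.ascFactorial_mul_ascFactorial, add_comm 1 r]
      push_cast
      simp
    rw [h, add_zero, altCoeff_ascFactorial]
    rcases s with _ | s <;> simp [placeForm]
  | succ a ih =>
    have h : (fun r => (((r + 1).ascFactorial c : ℕ) : ℤ) *
        (((1 + r + c).ascFactorial (a + 1) * (1 + r + c).ascFactorial b : ℕ) : ℤ)) =
        fun r : ℕ => (1 + (r : ℤ) + (c + b + a : ℕ) - b) * ((((r + 1).ascFactorial c : ℕ) : ℤ) *
        (((1 + r + c).ascFactorial a * (1 + r + c).ascFactorial b : ℕ) : ℤ)) := by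
      funext r
      rw [Nat.ascFactorial_succ]
      push_cast
      ring
    rw [h, ← add_assoc, ← add_assoc]
    rcases s with _ | s
    · rw [altCoeff_linear_zero, ih, placeForm_succ_zero]
      push_cast
      ring
    · rw [altCoeff_linear_succ, ih, ih, placeForm_succ_succ]
      push_cast
      ring

theorem cast_descFactorial_succ (x a : ℕ) :
    (x.descFactorial (a + 1) : ℤ) = (x - a) * x.descFactorial a := by
  rcases le_or_gt a x with h | h
  · rw [Nat.descFactorial_succ]
    push_cast [h]
    ring
  · simp [Nat.descFactorial_of_lt h]

/-- With m = c+a, the next factor r+c-a equals 1+r+m-(2a+1). -/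
theorem altSum_descFactorial (a c s : ℕ) :
    altSum c (c + a) s (fun r => (r + c).descFactorial a) = placeForm a a c c s := by
  rw [altSum_eq_altCoeff]
  simp only [factorial_mul_choose_eq_ascFactorial]
  induction a generalizing s with
  | zero =>
    simp only [Nat.descFactorial_zero, Nat.cast_one, mul_one, add_zero]
    rw [altCoeff_ascFactorial]
    rcases s with _ | s <;> simp [placeForm]
  | succ a ih =>
    have h : (fun r => (((r + 1).ascFactorial c : ℕ) : ℤ) * ((r + c).descFactorial (a + 1) : ℕ)) =
        fun r : ℕ => (1 + (r : ℤ) + (c + a : ℕ) - (2 * a + 1)) *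
          ((((r + 1).ascFactorial c : ℕ) : ℤ) * ((r + c).descFactorial a : ℕ)) := by
      funext r
      rw [cast_descFactorial_succ]
      push_cast
      ring
    rw [h, ← add_assoc]
    rcases s with _ | s
    · rw [altCoeff_linear_zero, ih, placeForm_diag_succ_zero]
      push_cast
      ring
    · rw [altCoeff_linear_succ, ih, ih, placeForm_diag_succ_succ]
      push_cast
      ring

/-- With m = c+a, the next factor 1+r+c-a equals 1+r+m-2a. -/
theorem altSum_descFactorial_succ (a c s : ℕ) :
    altSum c (c + a) s (fun r => (1 + r + c).descFactorial a) = adjForm a c s := by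
  rw [altSum_eq_altCoeff]
  simp only [factorial_mul_choose_eq_ascFactorial]
  induction a generalizing s with
  | zero =>
    simp only [Nat.descFactorial_zero, Nat.cast_one, mul_one, add_zero]
    rw [altCoeff_ascFactorial]
    rcases s with _ | s <;> simp [adjForm]
  | succ a ih =>
    have h : (fun r => (((r + 1).ascFactorial c : ℕ) : ℤ) *
          ((1 + r + c).descFactorial (a + 1) : ℕ)) =
        fun r : ℕ => (1 + (r : ℤ) + (c + a : ℕ) - 2 * a) *
          ((((r + 1).ascFactorial c : ℕ) : ℤ) * ((1 + r + c).descFactorial a : ℕ)) := by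
      funext r
      rw [cast_descFactorial_succ]
      push_cast
      ring
    rw [h, ← add_assoc]
    rcases s with _ | s
    · rw [altCoeff_linear_zero, ih, adjForm_succ_zero]
      push_cast
      ring
    · rw [altCoeff_linear_succ, ih, ih, adjForm_succ_succ]
      push_cast
      ring

/-! ### Adjacencies -/

open Classical in
-- The letters outside `X` come first and form no pairs. Each letter of `X` is then a source whose
-- targets are exactly the letters of `Y`, all in `zs` by disjointness, so d never changes.
theorem coeff_pairPoly_adj {X Y : Set ℕ} (hXY : Disjoint X Y) {xs zs : List ℕ} {p : ℕ}
    (hxs : ∀ x ∈ xs, x ∈ X) (hzs : ∀ z ∈ zs, z ∉ X) (hp : zs.length = zs.countP (· ∈ Y) + p)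
    (s : ℕ) :
    (pairPoly (fun a b => a ∈ X ∧ b ∈ Y) (xs ++ zs)).coeff s =
      placeForm xs.length (zs.countP (· ∈ Y)) (p + xs.length) zs.length s := by
  have hd : ∀ x ∈ X, x ∉ Y := fun x hx hy => Set.disjoint_left.1 hXY hx hy
  induction xs generalizing s with
  | nil =>
    rw [List.nil_append, pairPoly_eq_factorial fun x hx z _ h => hzs x hx h.1]
    rw [← Polynomial.C_eq_natCast, Polynomial.coeff_C]
    rcases s with _ | s <;> simp [placeForm]
  | cons x xs ih =>
    have hx : x ∈ X := hxs x (by simp)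
    have ih := ih fun x hx => hxs x (by simp [hx])
    rw [List.cons_append, pairPoly_cons_of_source (d := zs.countP (· ∈ Y))]
    · have hlen : ((xs ++ zs).length : ℤ) = xs.length + zs.countP (· ∈ Y) + p := by
        rw [List.length_append, hp]
        push_cast
        ring
      rw [List.length_cons, ← add_assoc]
      rcases s with _ | s
      · rw [coeff_source_step_zero, ih, placeForm_succ_zero, hlen]
        push_cast
        ring
      · rw [coeff_source_step_succ, ih, ih, placeForm_succ_succ, hlen]
        push_cast
        ring
    · exact fun z _ h => hd x hx h.2
    · exact fun _ _ _ _ h => ⟨hx, h.2⟩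
    · rw [List.countP_append]
      simp only [hx, true_and]
      refine Nat.add_eq_right.2 (List.countP_eq_zero.2 fun z hz => ?_)
      simpa using hd z (hxs z (by simp [hz]))

open Classical in
theorem coeff_pairPoly_adj_self {X : Set ℕ} {xs zs : List ℕ}
    (hxs : ∀ x ∈ xs, x ∈ X) (hzs : ∀ z ∈ zs, z ∉ X) (s : ℕ) :
    (pairPoly (fun a b => a ∈ X ∧ b ∈ X) (xs ++ zs)).coeff s =
      adjForm xs.length zs.length s := by
  induction xs generalizing s with
  | nil =>
    rw [List.nil_append, pairPoly_eq_factorial fun x hx z _ h => hzs x hx h.1]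
    rw [← Polynomial.C_eq_natCast, Polynomial.coeff_C]
    rcases s with _ | s <;> simp [adjForm]
  | cons x xs ih =>
    have ih := ih fun x hx => hxs x (by simp [hx])
    rw [List.cons_append, pairPoly_cons_of_mem (hxs x (by simp))]
    have hc : (xs ++ zs).countP (· ∈ X) = xs.length := by
      rw [List.countP_append, (List.countP_eq_zero (l := zs)).2 fun z hz => by simpa using hzs z hz, add_zero,
        List.countP_eq_length.2 fun x hx => by simpa using hxs x (by simp [hx])]
    rw [hc]
    -- The source step applies with d = 2a once 2a is the cast of one natural number.
    have h2 : (2 * (xs.length : Polynomial ℤ)) = ((2 * xs.length : ℕ) : Polynomial ℤ) := by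
      push_cast; rfl
    rw [h2, List.length_cons, List.length_append]
    rcases s with _ | s
    · rw [coeff_source_step_zero, ih, adjForm_succ_zero]
      push_cast
      ring
    · rw [coeff_source_step_succ, ih, ih, adjForm_succ_succ]
      push_cast
      ring

open Classical in
theorem countP_range'_eq_card (S : Set ℕ) (m : ℕ) :
    (List.range' 1 m).countP (· ∈ S) = #{z ∈ Icc 1 m | z ∈ S} := by
  have h := countP_range'_add S m
  have h2 := Finset.card_filter_add_card_filter_not (s := Ico 1 (m + 1)) (· ∈ S)
  have h3 : Ico 1 (m + 1) = Icc 1 m := by ext; simp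
  rw [h3] at h h2
  simp only [Nat.card_Icc] at h2
  omega

open Classical in
theorem numAdj_eq_placeForm {X Y : Set ℕ} (hXY : Disjoint X Y) {m a b p q : ℕ} (s : ℕ)
    (hX : #{z ∈ Icc 1 m | z ∈ X} = a) (hY : #{z ∈ Icc 1 m | z ∈ Y} = b)
    (ha : m = a + q) (hb : m = b + p) :
    numAdj m s X Y = placeForm a b p q s := by
  have hperm := List.filter_append_perm (fun z => decide (z ∈ X)) (List.range' 1 m)
  have hx := countP_range'_eq_card X m
  have hy := countP_range'_eq_card Y m
  have h := numAdj_eq_coeff s X Y hperm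
  set xs := (List.range' 1 m).filter fun z => decide (z ∈ X)
  set zs := (List.range' 1 m).filter fun z => !decide (z ∈ X)
  have hxs : ∀ x ∈ xs, x ∈ X := fun x hx => by simpa using (List.mem_filter.1 hx).2
  have hzs : ∀ z ∈ zs, z ∉ X := fun z hz => by simpa using (List.mem_filter.1 hz).2
  have hlen := hperm.length_eq
  rw [List.length_append, List.length_range'] at hlen
  rw [List.countP_eq_length_filter, hX] at hx
  change xs.length = a at hx
  have hy' : zs.countP (· ∈ Y) = b := by
    rw [← hY, ← hy, ← hperm.countP_eq, List.countP_append]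
    refine (Nat.add_eq_right.2 (List.countP_eq_zero.2 fun z hz => ?_)).symm
    simpa using Set.disjoint_left.1 hXY (hxs z hz)
  have hle : b ≤ zs.length := hy' ▸ List.countP_le_length
  rw [coeff_pairPoly_adj hXY hxs hzs (p := zs.length - b) (by omega), hx, hy'] at h
  rw [show zs.length = q by omega, show q - b + a = p by omega] at h
  exact_mod_cast h

open Classical in
theorem numAdj_self_eq_adjForm {X : Set ℕ} {m a q : ℕ} (s : ℕ)
    (hX : #{z ∈ Icc 1 m | z ∈ X} = a) (ha : m = a + q) :
    numAdj m s X X = adjForm a q s := by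
  have hperm := List.filter_append_perm (fun z => decide (z ∈ X)) (List.range' 1 m)
  have hx := countP_range'_eq_card X m
  have h := numAdj_eq_coeff s X X hperm
  set xs := (List.range' 1 m).filter fun z => decide (z ∈ X)
  set zs := (List.range' 1 m).filter fun z => !decide (z ∈ X)
  have hxs : ∀ x ∈ xs, x ∈ X := fun x hx => by simpa using (List.mem_filter.1 hx).2
  have hzs : ∀ z ∈ zs, z ∉ X := fun z hz => by simpa using (List.mem_filter.1 hz).2
  have hlen := hperm.length_eq
  rw [List.length_append, List.length_range'] at hlen
  rw [List.countP_eq_length_filter, hX] at hx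
  change xs.length = a at hx
  rw [coeff_pairPoly_adj_self hxs hzs, hx, show zs.length = q by omega] at h
  exact_mod_cast h

/-! ### Place-value pairs -/

section PlaceValue
variable {α : Type*} [Fintype α] [DecidableEq α]

theorem card_perm_map_eq_of_card_eq (P : Finset α) {T T' : Finset α} (h : #T = #T') :
    #{σ : Equiv.Perm α | P.map σ.toEmbedding = T} =
      #{σ : Equiv.Perm α | P.map σ.toEmbedding = T'} := by
  let e : {x // x ∈ T} ≃ {x // x ∈ T'} := Finset.equivOfCardEq h
  let τ : Equiv.Perm α := e.extendSubtype
  have hτ : T.map τ.toEmbedding = T' := by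
    refine Finset.eq_of_subset_of_card_le (fun y hy => ?_) (by rw [card_map, h])
    obtain ⟨x, hx, rfl⟩ := Finset.mem_map.1 hy
    exact e.extendSubtype_mem x hx
  refine Finset.card_bij (fun σ _ => τ * σ) ?_ (fun σ _ σ' _ h => mul_left_cancel h) ?_
  · intro σ hσ
    simp only [mem_filter, mem_univ, true_and] at hσ ⊢
    rw [← hτ, ← hσ, Finset.map_map]
    rfl
  · intro σ hσ
    simp only [mem_filter, mem_univ, true_and] at hσ
    refine ⟨τ⁻¹ * σ, ?_, by simp⟩
    simp only [mem_filter, mem_univ, true_and]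
    apply Finset.map_injective τ.toEmbedding
    rw [hτ, ← hσ, Finset.map_map]
    congr 1
    ext x
    simp

/-- All sets of size `#P` are images of `P` equally often, by left multiplication with a permutation
carrying one to another; dividing the number of all permutations by the number of such sets gives
the count. -/
theorem card_perm_map_eq {P T : Finset α} {q : ℕ} (hT : #T = #P)
    (hq : Fintype.card α = #P + q) :
    #{σ : Equiv.Perm α | P.map σ.toEmbedding = T} = (#P)! * q ! := by
  have h := Finset.card_eq_sum_card_fiberwise (s := (univ : Finset (Equiv.Perm α)))
    (t := powersetCard (#P) univ) (f := fun σ => P.map σ.toEmbedding) (by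
      intro σ _
      simp [mem_powersetCard])
  rw [Finset.sum_congr rfl fun T' hT' => card_perm_map_eq_of_card_eq P (T' := T)
    (by rw [(mem_powersetCard.1 hT').2, hT]), sum_const, card_powersetCard, card_univ, card_univ,
    Fintype.card_perm, smul_eq_mul, hq] at h
  have h2 := Nat.choose_mul_factorial_mul_factorial (Nat.le_add_right (#P) q)
  rw [Nat.add_sub_cancel_left, mul_assoc, h] at h2
  exact (Nat.eq_of_mul_eq_mul_left (Nat.choose_pos (Nat.le_add_right _ _)) h2).symm

theorem card_powersetCard_inter_eq (Q : Finset α) {a p s : ℕ} (hs : s ≤ a)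
    (hp : Fintype.card α = #Q + p) :
    #{T ∈ powersetCard a univ | #(T ∩ Q) = s} = (#Q).choose s * p.choose (a - s) := by
  have hc : #Qᶜ = p := by rw [card_compl, hp, Nat.add_sub_cancel_left]
  rw [← hc, ← card_powersetCard, ← card_powersetCard, ← card_product]
  refine Finset.card_nbij' (fun T => (T ∩ Q, T ∩ Qᶜ)) (fun U => U.1 ∪ U.2) ?_ ?_ ?_ ?_
  · intro T hT
    simp only [coe_filter, Set.mem_ofPred_eq, mem_powersetCard_univ] at hT
    have h1 := card_inter_add_card_sdiff T Q
    rw [sdiff_eq_inter_compl] at h1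
    simp only [coe_product, Set.mem_prod, mem_coe, mem_powersetCard]
    exact ⟨⟨inter_subset_right, hT.2⟩, inter_subset_right, by omega⟩
  · rintro ⟨U, V⟩ h
    simp only [coe_product, Set.mem_prod, mem_coe, mem_powersetCard] at h
    obtain ⟨⟨hU, hU'⟩, hV, hV'⟩ := h
    have hVQ : V ∩ Q = ∅ :=
      disjoint_iff_inter_eq_empty.1 (disjoint_compl_left.mono_left hV)
    have hUV : Disjoint U V := disjoint_compl_right.mono hU hV
    simp only [coe_filter, Set.mem_ofPred_eq, mem_powersetCard_univ]
    rw [card_union_of_disjoint hUV, union_inter_distrib_right, hVQ, union_empty,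
      inter_eq_left.2 hU]
    omega
  · intro T _
    simp only
    rw [← inter_union_distrib_left, union_compl, inter_univ]
  · rintro ⟨U, V⟩ h
    simp only [coe_product, Set.mem_prod, mem_coe, mem_powersetCard] at h
    obtain ⟨⟨hU, -⟩, hV, -⟩ := h
    have hVQ : V ∩ Q = ∅ :=
      disjoint_iff_inter_eq_empty.1 (disjoint_compl_left.mono_left hV)
    have hUQ : U ∩ Qᶜ = ∅ :=
      disjoint_iff_inter_eq_empty.1 (disjoint_compl_right.mono_left hU)
    simp only [union_inter_distrib_right, hVQ, hUQ, union_empty, empty_union,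
      inter_eq_left.2 hU, inter_eq_left.2 hV]

theorem card_perm_card_map_inter_eq (P Q : Finset α) {p q : ℕ} (s : ℕ)
    (hq : Fintype.card α = #P + q) (hp : Fintype.card α = #Q + p) :
    #{σ : Equiv.Perm α | #(P.map σ.toEmbedding ∩ Q) = s} = placeForm (#P) (#Q) p q s := by
  rcases lt_or_ge (#P) s with h | h
  · rw [placeForm_of_lt h, Finset.card_eq_zero, Finset.filter_eq_empty_iff]
    intro σ _ h'
    have := card_le_card (inter_subset_left (s₁ := P.map σ.toEmbedding) (s₂ := Q))
    rw [card_map] at this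
    omega
  · rw [Finset.card_eq_sum_card_fiberwise
      (t := {T ∈ powersetCard (#P) (univ : Finset α) | #(T ∩ Q) = s})
      (f := fun σ => P.map σ.toEmbedding) (by
        intro σ hσ
        simpa using hσ)]
    have hcong : ∀ T ∈ ({T ∈ powersetCard (#P) (univ : Finset α) | #(T ∩ Q) = s} :
        Finset (Finset α)),
        #{σ ∈ ({σ : Equiv.Perm α | #(P.map σ.toEmbedding ∩ Q) = s} : Finset _) |
          P.map σ.toEmbedding = T} = (#P)! * q ! := by
      intro T hT
      simp only [mem_filter, mem_powersetCard_univ] at hT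
      rw [← card_perm_map_eq hT.1 hq, filter_filter]
      congr 1
      ext σ
      simp only [mem_filter, mem_univ, true_and]
      exact ⟨fun h => h.2, fun h => ⟨h ▸ hT.2, h⟩⟩
    rw [sum_congr rfl hcong, sum_const, card_powersetCard_inter_eq Q h hp, smul_eq_mul, placeForm]
    have h2 := Nat.choose_mul_factorial_mul_factorial h
    rw [← h2]
    ring

end PlaceValue

open Classical in
theorem card_index_eq_card_Icc (S : Set ℕ) (m : ℕ) :
    #{i : Fin m | (i : ℕ) + 1 ∈ S} = #{z ∈ Icc 1 m | z ∈ S} := by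
  refine Finset.card_bij (fun i _ => (i : ℕ) + 1) ?_ ?_ ?_
  · intro i hi
    have := i.isLt
    simp only [mem_filter, mem_univ, true_and, mem_Icc] at hi ⊢
    exact ⟨by omega, hi⟩
  · intro i _ j _ h
    exact Fin.ext (by omega)
  · intro z hz
    simp only [mem_filter, mem_Icc] at hz
    refine ⟨⟨z - 1, by omega⟩, ?_, by simp; omega⟩
    simp only [mem_filter, mem_univ, true_and]
    rw [Nat.sub_add_cancel hz.1.1]
    exact hz.2

open Classical in
theorem numVal_eq_placeForm {X Y : Set ℕ} {m a b p q : ℕ} (s : ℕ)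
    (hX : #{z ∈ Icc 1 m | z ∈ X} = a) (hY : #{z ∈ Icc 1 m | z ∈ Y} = b)
    (ha : m = a + q) (hb : m = b + p) :
    numVal m s X Y = placeForm a b p q s := by
  rw [← card_index_eq_card_Icc] at hX hY
  have h := card_perm_card_map_inter_eq (α := Fin m) (p := p) (q := q)
    {i : Fin m | (i : ℕ) + 1 ∈ X} {i : Fin m | (i : ℕ) + 1 ∈ Y} s
    (by rw [hX, Fintype.card_fin, ha]) (by rw [hY, Fintype.card_fin, hb])
  rw [hX, hY] at h
  rw [← h, numVal]
  congr 1
  ext σ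
  simp only [mem_filter, mem_univ, true_and]
  suffices hs : valStat X Y σ = #(({i : Fin m | (i : ℕ) + 1 ∈ X} : Finset _).map σ.toEmbedding ∩
      ({i : Fin m | (i : ℕ) + 1 ∈ Y} : Finset _)) by rw [hs]
  rw [valStat, ← card_map σ.toEmbedding]
  congr 1
  ext j
  simp only [mem_map, mem_filter, mem_univ, true_and, mem_inter]
  constructor
  · rintro ⟨i, ⟨h1, h2⟩, rfl⟩
    exact ⟨⟨i, h1, rfl⟩, h2⟩
  · rintro ⟨⟨i, h1, rfl⟩, h2⟩
    exact ⟨i, ⟨h1, h2⟩, rfl⟩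

/-- Inversion exchanges places and values. -/
theorem numVal_comm (m s : ℕ) (X Y : Set ℕ) : numVal m s Y X = numVal m s X Y := by
  classical
  have h : ∀ (X Y : Set ℕ) (σ : Equiv.Perm (Fin m)), valStat X Y σ⁻¹ = valStat Y X σ := by
    intro X Y σ
    unfold valStat
    symm
    refine Finset.card_bij (fun i _ => σ i) ?_ (fun i _ j _ h => σ.injective h) ?_
    · intro i hi
      simp only [mem_filter, mem_univ, true_and] at hi ⊢
      simpa [letter, and_comm] using hi
    · intro i hi
      refine ⟨σ⁻¹ i, ?_, by simp⟩
      simp only [mem_filter, mem_univ, true_and] at hi ⊢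
      simpa [letter, and_comm] using hi
  unfold numVal
  refine Finset.card_bij (fun σ _ => σ⁻¹) ?_ (fun σ _ τ _ h => inv_injective h) ?_
  · intro σ hσ
    simpa [h] using hσ
  · intro σ hσ
    exact ⟨σ⁻¹, by simpa [h] using hσ, inv_inv σ⟩

/-! ### Arithmetic progressions -/

theorem add_mul_lt_iff {i j k : ℕ} (h1 : j ≤ i) (h2 : i < j + k) (a' a : ℕ) :
    i + k * a' < j + k * a ↔ a' < a := by
  constructor
  · intro h
    by_contra! h'
    have := Nat.mul_le_mul_left k h'
    omega
  · intro h
    have := Nat.mul_le_mul_left k (Nat.succ_le_of_lt h)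
    rw [Nat.succ_eq_add_one, mul_add] at this
    omega

theorem add_mul_lt_iff' {i j k : ℕ} (h1 : i < j) (h2 : j ≤ i + k) (a' a : ℕ) :
    i + k * a' < j + k * a ↔ a' < a + 1 := by
  constructor
  · intro h
    by_contra! h'
    have := Nat.mul_le_mul_left k h'
    rw [mul_add] at this
    omega
  · intro h
    have := Nat.mul_le_mul_left k (Nat.le_of_lt_succ h)
    omega

theorem disjoint_prog {i j k : ℕ} (h1 : i < j) (h2 : j < i + k) :
    Disjoint (prog i k) (prog j k) := by
  rw [Set.disjoint_left]
  rintro x ⟨a, rfl⟩ ⟨b, hb⟩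
  rcases le_or_gt a b with h | h
  · have := Nat.mul_le_mul_left k h
    omega
  · have := Nat.mul_le_mul_left k (Nat.succ_le_of_lt h)
    rw [Nat.succ_eq_add_one, mul_add] at this
    omega

open Classical in
theorem filter_mem_prog {j k q : ℕ} {s : Finset ℕ} (h : ∀ a, j + k * a ∈ s ↔ a < q) :
    {z ∈ s | z ∈ prog j k} = (range q).image fun a => j + k * a := by
  ext z
  simp only [mem_filter, mem_image, mem_range]
  constructor
  · rintro ⟨hz, a, rfl⟩
    exact ⟨a, (h a).1 hz, rfl⟩
  · rintro ⟨a, ha, rfl⟩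
    exact ⟨(h a).2 ha, a, rfl⟩

theorem add_mul_injective {k : ℕ} (hk : 0 < k) (j : ℕ) :
    Function.Injective fun a => j + k * a := by
  intro a b h
  exact Nat.eq_of_mul_eq_mul_left hk (Nat.add_left_cancel h)

open Classical in
theorem card_filter_mem_prog {j k q : ℕ} {s : Finset ℕ} (hk : 0 < k)
    (h : ∀ a, j + k * a ∈ s ↔ a < q) : #{z ∈ s | z ∈ prog j k} = q := by
  rw [filter_mem_prog h, card_image_of_injective _ (add_mul_injective hk j), card_range]

open Classical in
theorem filter_mem_union {s : Finset ℕ} {X Y U : Set ℕ} (hU : U = X ∪ Y) :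
    {z ∈ s | z ∈ U} = ({z ∈ s | z ∈ X} ∪ {z ∈ s | z ∈ Y} : Finset ℕ) := by
  subst hU
  ext z
  simp only [mem_filter, mem_union, Set.mem_union]
  tauto

theorem disjoint_filter_mem {s : Finset ℕ} {X Y : Set ℕ} [DecidablePred (· ∈ X)]
    [DecidablePred (· ∈ Y)] (h : Disjoint X Y) :
    Disjoint ({z ∈ s | z ∈ X} : Finset ℕ) {z ∈ s | z ∈ Y} :=
  disjoint_filter.2 fun _ _ h1 h2 => Set.disjoint_left.1 h h1 h2

open Classical in
theorem card_filter_mem_union {s : Finset ℕ} {X Y U : Set ℕ} (hU : U = X ∪ Y)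
    (h : Disjoint X Y) : #{z ∈ s | z ∈ U} = #{z ∈ s | z ∈ X} + #{z ∈ s | z ∈ Y} := by
  rw [filter_mem_union hU, card_union_of_disjoint (disjoint_filter_mem h)]

open Classical in
-- The complement of `A` splits at x; below x, the non-members of `A` and of `B` differ in number by
-- the difference of the members. Thus α+β is |A_m^c| plus the members of `A` below x minus those of
-- `B`.
theorem alphaStat_add_betaStat (A B : Set ℕ) {m x : ℕ} (hx : x ∈ A) (hx1 : 1 ≤ x) (hxm : x ≤ m) :
    alphaStat A m x + betaStat B x + #{z ∈ Ico 1 x | z ∈ B} =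
      #{z ∈ Icc 1 m | z ∉ A} + #{z ∈ Ico 1 x | z ∈ A} := by
  have h1 := card_filter_add_card_filter_not (s := Ico 1 x) (· ∈ A)
  have h2 := card_filter_add_card_filter_not (s := Ico 1 x) (· ∈ B)
  have h3 : #{z ∈ Icc 1 m | z ∉ A} = #{z ∈ Ico 1 x | z ∉ A} + #{z ∈ Ioc x m | z ∉ A} := by
    rw [← card_union_of_disjoint]
    · congr 1
      ext z
      simp only [mem_filter, mem_union, mem_Icc, mem_Ico, mem_Ioc]
      constructor
      · rintro ⟨h, hz⟩
        have : z ≠ x := fun h => hz (h ▸ hx)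
        rcases lt_or_gt_of_ne this with h' | h'
        · exact Or.inl ⟨⟨h.1, h'⟩, hz⟩
        · exact Or.inr ⟨⟨h', h.2⟩, hz⟩
      · rintro (⟨h, hz⟩ | ⟨h, hz⟩)
        · exact ⟨⟨h.1, by omega⟩, hz⟩
        · exact ⟨⟨by omega, h.2⟩, hz⟩
    · rw [disjoint_left]
      intro z hz hz'
      simp only [mem_filter, mem_Ico, mem_Ioc] at hz hz'
      omega
  rw [h3]
  unfold alphaStat betaStat
  omega

open Classical in
theorem card_filter_notMem_Icc {A : Set ℕ} {m a c : ℕ} (h : #{z ∈ Icc 1 m | z ∈ A} = a)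
    (hm : m = c + a) : #{z ∈ Icc 1 m | z ∉ A} = c := by
  have := card_filter_add_card_filter_not (s := Icc 1 m) (· ∈ A)
  simp only [Nat.card_Icc] at this
  omega

theorem mem_Icc_one_iff {i k m a : ℕ} (hi : 1 ≤ i) (ha : ∀ x, i + k * x ≤ m ↔ x < a) (x : ℕ) :
    i + k * x ∈ Icc 1 m ↔ x < a := by
  rw [← ha, mem_Icc]
  omega

theorem mem_Ico_one_iff {i k N a : ℕ} (hi : 1 ≤ i) (ha : ∀ x, i + k * x < N ↔ x < a) (x : ℕ) :
    i + k * x ∈ Ico 1 N ↔ x < a := by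
  rw [← ha, mem_Ico]
  omega

/-- Since α+β is c plus the number of terms of j+kℕ below the letter, the term of index x has α+β =
c+x in both progressions, which gives two rising factorials. -/
theorem hallRemmel_prog_union_prog {i j k m a b c : ℕ} (s : ℕ) (hi : 1 ≤ i) (hij : i < j)
    (hjk : j ≤ k) (ha : ∀ x, i + k * x ≤ m ↔ x < a) (hb : ∀ x, j + k * x ≤ m ↔ x < b)
    (hm : m = c + b + a) :
    hallRemmel m s (prog i k ∪ prog j k) (prog i k) = placeForm a b (c + a) (c + b) s := by
  classical
  have hk : 0 < k := by omega
  have hd : Disjoint (prog i k) (prog j k) := disjoint_prog hij (by omega)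
  have hi' := mem_Icc_one_iff hi ha
  have hj' := mem_Icc_one_iff (hi.trans hij.le) hb
  have hc := card_filter_notMem_Icc (A := prog i k ∪ prog j k) (m := m) (a := a + b) (c := c) (by
    rw [card_filter_mem_union rfl hd, card_filter_mem_prog hk hi', card_filter_mem_prog hk hj'])
    (by omega)
  rw [← altSum_ascFactorial_mul_ascFactorial, ← hm, hallRemmel, hc]
  congr 1
  funext r
  rw [filter_mem_union rfl, prod_union (disjoint_filter_mem hd),
    filter_mem_prog hi', filter_mem_prog hj', prod_image (add_mul_injective hk i).injOn,
    prod_image (add_mul_injective hk j).injOn, Nat.ascFactorial_eq_prod_range,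
    Nat.ascFactorial_eq_prod_range]
  congr 1
  · refine prod_congr rfl fun x hx => ?_
    have hx' := mem_Icc.1 ((hi' x).2 (mem_range.1 hx))
    have h := alphaStat_add_betaStat (prog i k ∪ prog j k) (prog i k)
      (Or.inl ⟨x, rfl⟩) hx'.1 hx'.2
    rw [card_filter_mem_union rfl hd, hc,
      card_filter_mem_prog hk (mem_Ico_one_iff hi fun y => add_mul_lt_iff le_rfl (by omega) y x),
      card_filter_mem_prog hk (mem_Ico_one_iff (hi.trans hij.le)
        fun y => add_mul_lt_iff hij.le (by omega) y x)] at h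
    omega
  · refine prod_congr rfl fun x hx => ?_
    have hx' := mem_Icc.1 ((hj' x).2 (mem_range.1 hx))
    have h := alphaStat_add_betaStat (prog i k ∪ prog j k) (prog i k)
      (Or.inr ⟨x, rfl⟩) hx'.1 hx'.2
    rw [card_filter_mem_union rfl hd, hc,
      card_filter_mem_prog hk (mem_Ico_one_iff hi fun y => add_mul_lt_iff' hij (by omega) y x),
      card_filter_mem_prog hk (mem_Ico_one_iff (hi.trans hij.le)
        fun y => add_mul_lt_iff le_rfl (by omega) y x)] at h
    omega

/-- Below i+kx lie x+1 terms of the progression from i-1, so α+β = c-x-1. For i = 1 that progression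
would start at 0, which is not a letter. -/
theorem hallRemmel_prog_pred {i k m a c : ℕ} (s : ℕ) (hi : 2 ≤ i) (hk : 2 ≤ k)
    (ha : ∀ x, i + k * x ≤ m ↔ x < a) (hm : m = c + a) :
    hallRemmel m s (prog i k) (prog (i - 1) k ∪ prog i k) = placeForm a a c c s := by
  classical
  have hk' : 0 < k := by omega
  have hd : Disjoint (prog (i - 1) k) (prog i k) := disjoint_prog (by omega) (by omega)
  have hi' := mem_Icc_one_iff (by omega) ha
  have hc : #{z ∈ Icc 1 m | z ∉ prog i k} = c :=
    card_filter_notMem_Icc (card_filter_mem_prog hk' hi') hm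
  rw [← altSum_descFactorial, ← hm, hallRemmel, hc]
  congr 1
  funext r
  rw [filter_mem_prog hi', prod_image (add_mul_injective hk' i).injOn,
    Nat.descFactorial_eq_prod_range]
  refine prod_congr rfl fun x hx => ?_
  have hx' := mem_Icc.1 ((hi' x).2 (mem_range.1 hx))
  have h := alphaStat_add_betaStat (prog i k) (prog (i - 1) k ∪ prog i k) ⟨x, rfl⟩ hx'.1 hx'.2
  rw [card_filter_mem_union rfl hd, hc,
    card_filter_mem_prog hk' (mem_Ico_one_iff (by omega)
      fun y => add_mul_lt_iff le_rfl (by omega) y x),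
    card_filter_mem_prog hk' (mem_Ico_one_iff (by omega)
      fun y => add_mul_lt_iff' (by omega) (by omega) y x)] at h
  omega

/-- Below i+kx lie x terms of the progression from i+1, so α+β = c-x. This includes i = k, where the
progression starts at k+1 and omits the letter 1. -/
theorem hallRemmel_prog_succ {i k m a c : ℕ} (s : ℕ) (hi : 1 ≤ i) (hk : 2 ≤ k)
    (ha : ∀ x, i + k * x ≤ m ↔ x < a) (hm : m = c + a) :
    hallRemmel m s (prog i k) (prog i k ∪ prog (i + 1) k) = adjForm a c s := by
  classical
  have hk' : 0 < k := by omega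
  have hd : Disjoint (prog i k) (prog (i + 1) k) := disjoint_prog (by omega) (by omega)
  have hi' := mem_Icc_one_iff hi ha
  have hc : #{z ∈ Icc 1 m | z ∉ prog i k} = c :=
    card_filter_notMem_Icc (card_filter_mem_prog hk' hi') hm
  rw [← altSum_descFactorial_succ, ← hm, hallRemmel, hc]
  congr 1
  funext r
  rw [filter_mem_prog hi', prod_image (add_mul_injective hk' i).injOn,
    Nat.descFactorial_eq_prod_range]
  refine prod_congr rfl fun x hx => ?_
  have hx' := mem_Icc.1 ((hi' x).2 (mem_range.1 hx))
  have h := alphaStat_add_betaStat (prog i k) (prog i k ∪ prog (i + 1) k) ⟨x, rfl⟩ hx'.1 hx'.2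
  rw [card_filter_mem_union rfl hd, hc,
    card_filter_mem_prog hk' (mem_Ico_one_iff hi fun y => add_mul_lt_iff le_rfl (by omega) y x),
    card_filter_mem_prog hk' (mem_Ico_one_iff (by omega)
      fun y => add_mul_lt_iff (by omega) (by omega) y x)] at h
  omega

/-! ### The main theorem -/

theorem add_mul_le_iff_of_lt {i k n t : ℕ} (hik : i ≤ k) (ht : t < i) (x : ℕ) :
    i + k * x ≤ k * n + t ↔ x < n := by
  rw [← add_mul_lt_iff (i := i) (j := t + 1) (k := k) (by omega) (by omega)]
  omega

theorem add_mul_le_iff_of_le {i k n t : ℕ} (hi : 1 ≤ i) (ht : i ≤ t) (htk : t < k) (x : ℕ) :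
    i + k * x ≤ k * n + t ↔ x < n + 1 := by
  rw [← add_mul_lt_iff' (i := i) (j := t + 1) (k := k) (by omega) (by omega)]
  omega

theorem mainTheorem6 (k n t m s : ℕ) (hk : 2 ≤ k) (ht : t < k) (hm : m = k * n + t) :
    -- Two different residue classes; the class of `0` is represented by `k`.
    (∀ i j : ℕ, 1 ≤ i → i < j → j ≤ k →
      numVal m s (prog i k) (prog j k) = numAdj m s (prog i k) (prog j k) ∧
      numVal m s (prog j k) (prog i k) = numVal m s (prog i k) (prog j k) ∧
      numAdj m s (prog j k) (prog i k) = numAdj m s (prog i k) (prog j k) ∧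
      numDes m s (prog i k ∪ prog j k) (prog i k) = numVal m s (prog i k) (prog j k) ∧
      (numDes m s (prog i k ∪ prog j k) (prog i k) : ℤ) =
        hallRemmel m s (prog i k ∪ prog j k) (prog i k) ∧
      (t < i →
        numVal m s (prog i k) (prog j k) =
          n.choose s ^ 2 * ((k - 1) * n + t).choose (n - s) * s ! * (n - s)! *
            ((k - 1) * n + t)! ∧
        hallRemmel m s (prog i k ∪ prog j k) (prog i k) =
          altSum ((k - 2) * n + t) (k * n + t) s (fun r =>
            (1 + r + (k - 2) * n + t).ascFactorial n *
              (1 + r + (k - 2) * n + t).ascFactorial n)) ∧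
      (i ≤ t → t < j →
        numVal m s (prog i k) (prog j k) =
          (n + 1).choose s * n.choose s * ((k - 1) * n + t).choose (n + 1 - s) * s ! *
            (n + 1 - s)! * ((k - 1) * n + t - 1)! ∧
        hallRemmel m s (prog i k ∪ prog j k) (prog i k) =
          altSum ((k - 2) * n + t - 1) (k * n + t) s (fun r =>
            (r + (k - 2) * n + t).ascFactorial (n + 1) *
              (r + (k - 2) * n + t).ascFactorial n)) ∧
      (j ≤ t →
        numVal m s (prog i k) (prog j k) =
          (n + 1).choose s ^ 2 * ((k - 1) * n + t - 1).choose (n + 1 - s) * s ! *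
            (n + 1 - s)! * ((k - 1) * n + t - 1)! ∧
        hallRemmel m s (prog i k ∪ prog j k) (prog i k) =
          altSum ((k - 2) * n + t - 2) (k * n + t) s (fun r =>
            (r + (k - 2) * n + t - 1).ascFactorial (n + 1) *
              (r + (k - 2) * n + t - 1).ascFactorial (n + 1)))) ∧
    -- One residue class.
    (∀ i : ℕ, 1 ≤ i → i ≤ k →
      -- Place-value pairs: closed forms.
      (t < i →
        numVal m s (prog i k) (prog i k) =
          n.choose s ^ 2 * ((k - 1) * n + t).choose (n - s) * s ! * (n - s)! *
            ((k - 1) * n + t)!) ∧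
      (i ≤ t →
        numVal m s (prog i k) (prog i k) =
          (n + 1).choose s ^ 2 * ((k - 1) * n + t - 1).choose (n + 1 - s) * s ! *
            (n + 1 - s)! * ((k - 1) * n + t - 1)!) ∧
      -- Place-value pairs: the matching descents.
      (2 ≤ i →
        numDes m s (prog i k) (prog (i - 1) k ∪ prog i k) =
          numVal m s (prog i k) (prog i k) ∧
        (numDes m s (prog i k) (prog (i - 1) k ∪ prog i k) : ℤ) =
          hallRemmel m s (prog i k) (prog (i - 1) k ∪ prog i k) ∧
        (t < i →
          hallRemmel m s (prog i k) (prog (i - 1) k ∪ prog i k) =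
            altSum ((k - 1) * n + t) (k * n + t) s (fun r =>
              (r + (k - 1) * n + t).descFactorial n)) ∧
        (i ≤ t →
          hallRemmel m s (prog i k) (prog (i - 1) k ∪ prog i k) =
            altSum ((k - 1) * n + t - 1) (k * n + t) s (fun r =>
              (r + (k - 1) * n + t - 1).descFactorial (n + 1)))) ∧
      -- Adjacencies: the matching descents and the closed forms.
      numDes m s (prog i k) (prog i k ∪ prog (i + 1) k) = numAdj m s (prog i k) (prog i k) ∧
      (numDes m s (prog i k) (prog i k ∪ prog (i + 1) k) : ℤ) =
        hallRemmel m s (prog i k) (prog i k ∪ prog (i + 1) k) ∧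
      (t < i →
        numAdj m s (prog i k) (prog i k) =
          n ! * ((k - 1) * n + t)! * (n - 1).choose s * ((k - 1) * n + t + 1).choose (n - s) ∧
        hallRemmel m s (prog i k) (prog i k ∪ prog (i + 1) k) =
          altSum ((k - 1) * n + t) (k * n + t) s (fun r =>
            (1 + r + (k - 1) * n + t).descFactorial n)) ∧
      (i ≤ t →
        numAdj m s (prog i k) (prog i k) =
          (n + 1)! * ((k - 1) * n + t - 1)! * n.choose s *
            ((k - 1) * n + t).choose (n + 1 - s) ∧
        hallRemmel m s (prog i k) (prog i k ∪ prog (i + 1) k) =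
          altSum ((k - 1) * n + t - 1) (k * n + t) s (fun r =>
            (r + (k - 1) * n + t).descFactorial (n + 1)))) ∧
    -- The resulting identities, wherever all factorials in them make sense.
    (((n.choose s ^ 2 * ((k - 1) * n + t).choose (n - s) * s ! * (n - s)! *
          ((k - 1) * n + t)! : ℕ) : ℤ) =
        altSum ((k - 2) * n + t) (k * n + t) s (fun r =>
          (1 + r + (k - 2) * n + t).ascFactorial n *
            (1 + r + (k - 2) * n + t).ascFactorial n)) ∧
    (1 ≤ (k - 2) * n + t →
      (((n + 1).choose s * n.choose s * ((k - 1) * n + t).choose (n + 1 - s) * s ! *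
          (n + 1 - s)! * ((k - 1) * n + t - 1)! : ℕ) : ℤ) =
        altSum ((k - 2) * n + t - 1) (k * n + t) s (fun r =>
          (r + (k - 2) * n + t).ascFactorial (n + 1) *
            (r + (k - 2) * n + t).ascFactorial n)) ∧
    (2 ≤ (k - 2) * n + t →
      (((n + 1).choose s ^ 2 * ((k - 1) * n + t - 1).choose (n + 1 - s) * s ! *
          (n + 1 - s)! * ((k - 1) * n + t - 1)! : ℕ) : ℤ) =
        altSum ((k - 2) * n + t - 2) (k * n + t) s (fun r =>
          (r + (k - 2) * n + t - 1).ascFactorial (n + 1) *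
            (r + (k - 2) * n + t - 1).ascFactorial (n + 1))) ∧
    (((n.choose s ^ 2 * ((k - 1) * n + t).choose (n - s) * s ! * (n - s)! *
          ((k - 1) * n + t)! : ℕ) : ℤ) =
        altSum ((k - 1) * n + t) (k * n + t) s (fun r =>
          (r + (k - 1) * n + t).descFactorial n)) ∧
    (1 ≤ (k - 1) * n + t →
      (((n + 1).choose s ^ 2 * ((k - 1) * n + t - 1).choose (n + 1 - s) * s ! *
          (n + 1 - s)! * ((k - 1) * n + t - 1)! : ℕ) : ℤ) =
        altSum ((k - 1) * n + t - 1) (k * n + t) s (fun r =>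
          (r + (k - 1) * n + t - 1).descFactorial (n + 1))) ∧
    (((n ! * ((k - 1) * n + t)! * (n - 1).choose s *
          ((k - 1) * n + t + 1).choose (n - s) : ℕ) : ℤ) =
        altSum ((k - 1) * n + t) (k * n + t) s (fun r =>
          (1 + r + (k - 1) * n + t).descFactorial n)) ∧
    (1 ≤ (k - 1) * n + t →
      (((n + 1)! * ((k - 1) * n + t - 1)! * n.choose s *
          ((k - 1) * n + t).choose (n + 1 - s) : ℕ) : ℤ) =
        altSum ((k - 1) * n + t - 1) (k * n + t) s (fun r =>
          (r + (k - 1) * n + t).descFactorial (n + 1))) := by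
  subst hm
  obtain ⟨M, hM⟩ : ∃ M, (k - 2) * n + t = M := ⟨_, rfl⟩
  obtain ⟨N, hN⟩ : ∃ N, (k - 1) * n + t = N := ⟨_, rfl⟩
  have hNM : N = M + n := by
    obtain ⟨l, rfl⟩ := Nat.exists_eq_add_of_le' hk
    rw [← hN, ← hM, show l + 2 - 1 = l + 1 by omega, Nat.add_sub_cancel]
    ring
  have hm : k * n + t = N + n := by
    obtain ⟨l, rfl⟩ := Nat.exists_eq_add_of_le' hk
    rw [← hN, show l + 2 - 1 = l + 1 by omega]
    ring
  -- These bounds ensure that `M - 1`, `M - 2` and `N - 1` are not truncated in the cases i ≤ t and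
  -- j ≤ t.
  have htM : t ≤ M := by omega
  have htN : t ≤ N := by omega
  have hlt : ∀ {i}, i ≤ k → t < i → ∀ x, i + k * x ≤ N + n ↔ x < n := by
    intro i hik hti x
    rw [← hm, add_mul_le_iff_of_lt hik hti]
  have hle : ∀ {i}, 1 ≤ i → i ≤ t → ∀ x, i + k * x ≤ N + n ↔ x < n + 1 := by
    intro i hi hti x
    rw [← hm, add_mul_le_iff_of_le hi hti ht]
  have hk0 : 0 < k := by omega
  -- Right association exposes (k-2)n+t and (k-1)n+t inside longer sums, so that they fold to M and
  -- N; the next line restores left association.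
  simp only [add_assoc, hM, hN, hm]
  simp only [← add_assoc]
  have F1 : n.choose s ^ 2 * N.choose (n - s) * s ! * (n - s)! * N ! = placeForm n n N N s := by
    rw [placeForm, sq]
  have F2 : (n + 1).choose s * n.choose s * N.choose (n + 1 - s) * s ! * (n + 1 - s)! *
      (N - 1)! = placeForm (n + 1) n N (N - 1) s := rfl
  have F3 : (n + 1).choose s ^ 2 * (N - 1).choose (n + 1 - s) * s ! * (n + 1 - s)! *
      (N - 1)! = placeForm (n + 1) (n + 1) (N - 1) (N - 1) s := by
    rw [placeForm, sq]
  have FA : n ! * N ! * (n - 1).choose s * (N + 1).choose (n - s) = adjForm n N s := rfl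
  have FB : 1 ≤ N → (n + 1)! * (N - 1)! * n.choose s * N.choose (n + 1 - s) =
      adjForm (n + 1) (N - 1) s := by
    intro h
    rw [adjForm, Nat.add_sub_cancel, Nat.sub_add_cancel h]
  have S1 : altSum M (N + n) s (fun r => (1 + r + M).ascFactorial n *
      (1 + r + M).ascFactorial n) = placeForm n n N N s := by
    rw [hNM, altSum_ascFactorial_mul_ascFactorial]
  have S2 : 1 ≤ M → altSum (M - 1) (N + n) s (fun r => (r + M).ascFactorial (n + 1) *
      (r + M).ascFactorial n) = placeForm (n + 1) n N (N - 1) s := by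
    intro h
    obtain ⟨c, rfl⟩ := Nat.exists_eq_add_of_le' h
    rw [hNM, show c + 1 + n = c + (n + 1) by ring, show c + (n + 1) - 1 = c + n by omega,
      ← altSum_ascFactorial_mul_ascFactorial, show c + n + (n + 1) = c + (n + 1) + n by ring]
    simp only [Nat.add_sub_cancel, show ∀ r, 1 + r + c = r + (c + 1) by intro r; ring]
  have S3 : 2 ≤ M → altSum (M - 2) (N + n) s (fun r => (r + M - 1).ascFactorial (n + 1) *
      (r + M - 1).ascFactorial (n + 1)) = placeForm (n + 1) (n + 1) (N - 1) (N - 1) s := by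
    intro h
    obtain ⟨c, rfl⟩ := Nat.exists_eq_add_of_le' h
    rw [hNM, show c + 2 + n - 1 = c + (n + 1) by omega,
      ← altSum_ascFactorial_mul_ascFactorial, show c + (n + 1) + (n + 1) = c + 2 + n + n by ring]
    simp only [Nat.add_sub_cancel, show ∀ r, r + (c + 2) - 1 = 1 + r + c by intro r; omega]
  have SI : altSum N (N + n) s (fun r => (r + N).descFactorial n) = placeForm n n N N s :=
    altSum_descFactorial n N s
  have SII : 1 ≤ N → altSum (N - 1) (N + n) s (fun r => (r + N - 1).descFactorial (n + 1)) =
      placeForm (n + 1) (n + 1) (N - 1) (N - 1) s := by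
    intro h
    rw [← altSum_descFactorial, show N - 1 + (n + 1) = N + n by omega]
    simp only [Nat.add_sub_assoc h]
  have SA : altSum N (N + n) s (fun r => (1 + r + N).descFactorial n) = adjForm n N s :=
    altSum_descFactorial_succ n N s
  have SB : 1 ≤ N → altSum (N - 1) (N + n) s (fun r => (r + N).descFactorial (n + 1)) =
      adjForm (n + 1) (N - 1) s := by
    intro h
    rw [← altSum_descFactorial_succ, show N - 1 + (n + 1) = N + n by omega]
    simp only [show ∀ r, 1 + r + (N - 1) = r + N by intro r; omega]
  rw [F1, F2, F3, FA]
  refine ⟨?_, ?_, S1.symm, fun h => (S2 h).symm, fun h => (S3 h).symm, SI.symm,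
    fun h => (SII h).symm, SA.symm, fun h => by rw [FB h, SB h]⟩
  · intro i j hi hij hjk
    have hj : 1 ≤ j := hi.trans hij.le
    have hik : i ≤ k := hij.le.trans hjk
    have hd : Disjoint (prog i k) (prog j k) := disjoint_prog hij (by omega)
    -- Here a and b are the sizes of the two classes in [m] and c counts the letters in neither; the
    -- three ranges of t differ only in these sizes.
    have key : ∀ a b p q c, (∀ x, i + k * x ≤ N + n ↔ x < a) →
        (∀ x, j + k * x ≤ N + n ↔ x < b) → N + n = c + b + a → p = c + a → q = c + b →
        numVal (N + n) s (prog i k) (prog j k) = placeForm a b p q s ∧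
        numAdj (N + n) s (prog i k) (prog j k) = placeForm a b p q s ∧
        numAdj (N + n) s (prog j k) (prog i k) = placeForm a b p q s ∧
        hallRemmel (N + n) s (prog i k ∪ prog j k) (prog i k) = placeForm a b p q s := by
      rintro a b p q c ha hb h rfl rfl
      have hca := card_filter_mem_prog hk0 (mem_Icc_one_iff hi ha)
      have hcb := card_filter_mem_prog hk0 (mem_Icc_one_iff hj hb)
      have hV := numVal_eq_placeForm s hca hcb (p := c + a) (q := c + b) (by omega) (by omega)
      refine ⟨hV, numAdj_eq_placeForm hd s hca hcb (by omega) (by omega), ?_,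
        hallRemmel_prog_union_prog s hi hij hjk ha hb h⟩
      -- The symmetry of `placeForm` under exchanging the two sets is taken from `numVal_comm`
      -- instead of algebra.
      rw [numAdj_eq_placeForm hd.symm s hcb hca (p := c + b) (q := c + a) (by omega) (by omega),
        ← hV, ← numVal_comm,
        numVal_eq_placeForm s hcb hca (p := c + b) (q := c + a) (by omega) (by omega)]
    have hall : ∃ f : ℕ, numVal (N + n) s (prog i k) (prog j k) = f ∧
        numAdj (N + n) s (prog i k) (prog j k) = f ∧
        numAdj (N + n) s (prog j k) (prog i k) = f ∧
        hallRemmel (N + n) s (prog i k ∪ prog j k) (prog i k) = f := by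
      rcases lt_or_ge t i with h | h
      · exact ⟨_, key n n N N M (hlt hik h) (hlt hjk (h.trans hij)) (by omega) hNM hNM⟩
      · rcases lt_or_ge t j with h' | h'
        · exact ⟨_, key (n + 1) n N (N - 1) (M - 1) (hle hi h) (hlt hjk h') (by omega)
            (by omega) (by omega)⟩
        · exact ⟨_, key (n + 1) (n + 1) (N - 1) (N - 1) (M - 2) (hle hi h) (hle hj h') (by omega)
            (by omega) (by omega)⟩
    obtain ⟨f, h1, h2, h3, h4⟩ := hall
    have hD := numDes_eq_hallRemmel (N + n) s (prog i k ∪ prog j k) (prog i k)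
    refine ⟨h1.trans h2.symm, numVal_comm _ _ _ _, h3.trans h2.symm, ?_, hD, ?_, ?_, ?_⟩
    · rw [h1]
      exact_mod_cast hD.trans h4
    · intro h
      have := key n n N N M (hlt hik h) (hlt hjk (h.trans hij)) (by omega) hNM hNM
      exact ⟨this.1, this.2.2.2.trans S1.symm⟩
    · intro h h'
      have := key (n + 1) n N (N - 1) (M - 1) (hle hi h) (hlt hjk h') (by omega)
        (by omega) (by omega)
      exact ⟨this.1, this.2.2.2.trans (S2 (by omega)).symm⟩
    · intro h'
      have := key (n + 1) (n + 1) (N - 1) (N - 1) (M - 2) (hle hi (hij.le.trans h')) (hle hj h')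
        (by omega) (by omega) (by omega)
      exact ⟨this.1, this.2.2.2.trans (S3 (by omega)).symm⟩
  · intro i hi hik
    have hV : ∀ a q, (∀ x, i + k * x ≤ N + n ↔ x < a) → N + n = q + a →
        numVal (N + n) s (prog i k) (prog i k) = placeForm a a q q s := by
      intro a q ha h
      have hca := card_filter_mem_prog hk0 (mem_Icc_one_iff hi ha)
      exact numVal_eq_placeForm s hca hca (by omega) (by omega)
    have hA : ∀ a q, (∀ x, i + k * x ≤ N + n ↔ x < a) → N + n = q + a →
        numAdj (N + n) s (prog i k) (prog i k) = adjForm a q s := by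
      intro a q ha h
      exact numAdj_self_eq_adjForm s (card_filter_mem_prog hk0 (mem_Icc_one_iff hi ha)) (by omega)
    have hcount : ∃ a q, (∀ x, i + k * x ≤ N + n ↔ x < a) ∧ N + n = q + a := by
      rcases lt_or_ge t i with h | h
      · exact ⟨n, N, hlt hik h, rfl⟩
      · exact ⟨n + 1, N - 1, hle hi h, by omega⟩
    obtain ⟨a, q, ha, hq⟩ := hcount
    refine ⟨fun h => hV n N (hlt hik h) rfl, fun h => hV (n + 1) (N - 1) (hle hi h) (by omega),
      fun hi2 => ⟨?_, numDes_eq_hallRemmel _ _ _ _, fun h => ?_, fun h => ?_⟩, ?_,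
      numDes_eq_hallRemmel _ _ _ _, fun h => ⟨hA n N (hlt hik h) rfl, ?_⟩, fun h => ⟨?_, ?_⟩⟩
    · have h := numDes_eq_hallRemmel (N + n) s (prog i k) (prog (i - 1) k ∪ prog i k)
      rw [hallRemmel_prog_pred s hi2 hk ha hq, ← hV a q ha hq] at h
      exact_mod_cast h
    · rw [hallRemmel_prog_pred s hi2 hk (hlt hik h) rfl, SI]
    · rw [hallRemmel_prog_pred (c := N - 1) s hi2 hk (hle hi h) (by omega), SII (by omega)]
    · have h := numDes_eq_hallRemmel (N + n) s (prog i k) (prog i k ∪ prog (i + 1) k)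
      rw [hallRemmel_prog_succ s hi hk ha hq, ← hA a q ha hq] at h
      exact_mod_cast h
    · rw [hallRemmel_prog_succ s hi hk (hlt hik h) rfl, SA]
    · rw [FB (by omega)]
      exact hA (n + 1) (N - 1) (hle hi h) (by omega)
    · rw [hallRemmel_prog_succ (c := N - 1) s hi hk (hle hi h) (by omega), SB (by omega)]
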